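/- Let $\mathbb{T}$ be a dependent type theory, i.e. a set of derivable judgements $(\Gamma)\ A \in \mathrm{Type}$, $(\Gamma)\ a \in A$, $(\Gamma)\ A = B \in \mathrm{Type}$, $(\Gamma)\ a = b \in A$ over a syntax with variable binding, closed under the usual structural rules (assumption, weakening, substitution, definitional equality is an equivalence relation preserved by substitution, and conversion). Assume that $\mathbb{T}$ has identity types: for each context $\Gamma$ (left implicit), - (formation) if $A \in \mathrm{Type}$ and $a, b \in A$, then $\mathrm{Id}_A(a,b) \in \mathrm{Type}$; - (introduction) if $a \in A$, then $\mathrm{r}(a) \in \mathrm{Id}_A(a,a)$; - (elimination) if $\Theta(x,y,u)$ is a dependent context and $C(x,y,u)$ a type relative to $(x \in A, y \in A, u \in \mathrm{Id}_A(x,y))$ and to $(x \in A, y \in A, u \in \mathrm{Id}_A(x,y), \Theta(x,y,u))$ respectively, if $p \in \mathrm{Id}_A(a,b)$, and if $(x \in A, \Theta(x,x,\mathrm{r}(x)))\ d(x) \in C(x,x,\mathrm{r}(x))$, then $(\Theta(a,b,p))\ \mathrm{J}(a,b,p,d) \in C(a,b,p)$; - (computation) under the same assumptions, $(\Theta(a,a,\mathrm{r}(a)))\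 \mathrm{J}(a,a,\mathrm{r}(a),d) = d(a) \in C(a,a,\mathrm{r}(a))$; and $\mathrm{Id}$, $\mathrm{r}$ and $\mathrm{J}$ commute with substitution up to definitional equality. Let $\mathcal{C}(\mathbb{T})$ be the classifying category of $\mathbb{T}$: its objects are the well-formed contexts, up to renaming of variables and componentwise definitional equality; its maps are the context morphisms, up to renaming of variables and pointwise definitional equality; composition is substitution. Let $\mathcal{D}$ be the class of display maps, i.e. of the projections $(\Gamma, x \in A) \to \Gamma$, where $A$ is a type relative to the context $\Gamma$. A dependent projection is a projection $(\Gamma, \Phi) \to \Gamma$, where $\Phi$ is a (possibly empty) dependent context relative to $\Gamma$. Let $\mathcal{A} = {}^{\pitchfork}\mathcal{D}$ be the class of maps with the left lifting property with respect to every display map, and let $\mathcal{B} = \mathcal{A}^{\pitchfork}$ be the class of maps with the right lifting property with respect to every map in $\mathcal{A}$. Then $(\mathcal{A}, \mathcal{B})$ is a weak factorisation system on $\mathcal{C}(\mathbb{T})$: every map $f$ factors as $f = p \circ i$ with $i \in \mathcal{A}$ and $p \in \mathcal{B}$, and $\mathcal{A}^{\pitchfork} = \mathcal{B}$ and $\mathcal{A}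 = {}^{\pitchfork}\mathcal{B}$. Moreover, every map $f$ of $\mathcal{C}(\mathbb{T})$ factors as $f = p \circ i$ with $i \in \mathcal{A}$ and $p$ a dependent projection. -/

import Mathlib

universe u

namespace TypeTheory

/-! ## Raw syntax with binding -/

/-- A binding signature: each operation symbol `o` has `arity o` arguments, the `i`-th of which
binds `binds o i` variables. -/
structure Signature where
  Op : Type u
  arity : Op → ℕ
  binds : (o : Op) → Fin (arity o) → ℕ

/-- Raw expressions in `n` free variables, up to renaming of variables (de Bruijn indices: `0` is
the variable declared last). Types and elements are singled out by the judgements. -/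
inductive Exp (S : Signature.{u}) : ℕ → Type u
  | var {n : ℕ} (i : Fin n) : Exp S n
  | op {n : ℕ} (o : S.Op) (args : (i : Fin (S.arity o)) → Exp S (n + S.binds o i)) : Exp S n

/-- Sequences of `n` expressions in `m` variables, as simultaneous substitutions. -/
abbrev Sub (S : Signature.{u}) (n m : ℕ) : Type u := Fin n → Exp S m

variable {S : Signature.{u}}

/-- A renaming carried under `k` binders. -/
def liftRen {n m : ℕ} (ρ : Fin n → Fin m) : (k : ℕ) → Fin (n + k) → Fin (m + k)
  | 0 => ρ
  | k + 1 => Fin.cons 0 (fun i => (liftRen ρ k i).succ)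

def Exp.ren : {n m : ℕ} → Exp S n → (Fin n → Fin m) → Exp S m
  | _, _, .var i, ρ => .var (ρ i)
  | _, _, .op o args, ρ => .op o (fun i => (args i).ren (liftRen ρ (S.binds o i)))

/-- A substitution carried under `k` binders. -/
def Sub.lift {n m : ℕ} (σ : Sub S n m) : (k : ℕ) → Sub S (n + k) (m + k)
  | 0 => σ
  | k + 1 => Fin.cons (.var 0) (fun i => (Sub.lift σ k i).ren Fin.succ)

/-- Simultaneous (capture-avoiding) substitution. -/
def Exp.subst : {n m : ℕ} → Exp S n → Sub S n m → Exp S m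
  | _, _, .var i, σ => σ i
  | _, _, .op o args, σ => .op o (fun i => (args i).subst (σ.lift (S.binds o i)))

/-- The identity substitution. -/
def Sub.id (n : ℕ) : Sub S n n := fun i => .var i

/-- Weakening by the last `k` variables. -/
def Sub.wk (n k : ℕ) : Sub S n (n + k) := fun i => .var (i.addNat k)

/-- The substitution `[a/x]` for the last variable `x`. -/
def Sub.inst {n : ℕ} (a : Exp S n) : Sub S (n + 1) n := Fin.cons a (Sub.id n)

/-- Substitution of one sequence in another: `σ`, then `τ`. -/
def Sub.comp {n m l : ℕ} (σ : Sub S n m) (τ : Sub S m l) : Sub S n l := fun i => (σ i).subst τ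

/-- `A` regarded in one more variable. -/
def Exp.wk {n : ℕ} (A : Exp S n) : Exp S (n + 1) := A.subst (Sub.wk n 1)

section RawLemmas

theorem liftRen_comp {n m l : ℕ} (ρ : Fin n → Fin m) (ρ' : Fin m → Fin l) (k : ℕ) :
    liftRen (ρ' ∘ ρ) k = liftRen ρ' k ∘ liftRen ρ k := by
  induction k with
  | zero => rfl
  | succ k ih =>
    funext i
    refine Fin.cases rfl (fun i => ?_) i
    simp [liftRen, ih]

theorem Exp.ren_ren {n m l : ℕ} (e : Exp S n) (ρ : Fin n → Fin m) (ρ' : Fin m → Fin l) :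
    (e.ren ρ).ren ρ' = e.ren (ρ' ∘ ρ) := by
  induction e generalizing m l with
  | var i => rfl
  | op o args ih =>
    simp only [Exp.ren, liftRen_comp]
    congr 1
    funext i
    exact ih i _ _

theorem Sub.lift_ren {n m l : ℕ} (ρ : Fin n → Fin m) (σ : Sub S m l) (k : ℕ) :
    Sub.lift (σ ∘ ρ) k = Sub.lift σ k ∘ liftRen ρ k := by
  induction k with
  | zero => rfl
  | succ k ih =>
    funext i
    refine Fin.cases rfl (fun i => ?_) i
    simp [Sub.lift, liftRen, ih]

theorem Exp.ren_subst {n m l : ℕ} (e : Exp S n) (ρ : Fin n → Fin m) (σ : Sub S m l) :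
    (e.ren ρ).subst σ = e.subst (σ ∘ ρ) := by
  induction e generalizing m l with
  | var i => rfl
  | op o args ih =>
    simp only [Exp.ren, Exp.subst, Sub.lift_ren]
    congr 1
    funext i
    exact ih i _ _

theorem Sub.ren_lift {n m l : ℕ} (σ : Sub S n m) (ρ : Fin m → Fin l) (k : ℕ) :
    Sub.lift (fun i => (σ i).ren ρ) k = fun i => (Sub.lift σ k i).ren (liftRen ρ k) := by
  induction k with
  | zero => rfl
  | succ k ih =>
    funext i
    refine Fin.cases rfl (fun i => ?_) i
    simp only [Sub.lift, liftRen, ih, Fin.cons_succ, Exp.ren_ren]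
    congr 1

theorem Exp.subst_ren {n m l : ℕ} (e : Exp S n) (σ : Sub S n m) (ρ : Fin m → Fin l) :
    (e.subst σ).ren ρ = e.subst (fun i => (σ i).ren ρ) := by
  induction e generalizing m l with
  | var i => rfl
  | op o args ih =>
    simp only [Exp.ren, Exp.subst, Sub.ren_lift]
    congr 1
    funext i
    exact ih i _ _

theorem Sub.lift_comp {n m l : ℕ} (σ : Sub S n m) (τ : Sub S m l) (k : ℕ) :
    (σ.comp τ).lift k = (σ.lift k).comp (τ.lift k) := by
  induction k with
  | zero => rfl
  | succ k ih =>
    funext i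
    refine Fin.cases rfl (fun i => ?_) i
    simp only [Sub.lift, Sub.comp, ih, Fin.cons_succ, Exp.ren_subst, Exp.subst_ren]
    congr 1

theorem Exp.subst_subst {n m l : ℕ} (e : Exp S n) (σ : Sub S n m) (τ : Sub S m l) :
    (e.subst σ).subst τ = e.subst (σ.comp τ) := by
  induction e generalizing m l with
  | var i => rfl
  | op o args ih =>
    simp only [Exp.subst, Sub.lift_comp]
    congr 1
    funext i
    exact ih i _ _

theorem Sub.lift_id (n k : ℕ) : (Sub.id n : Sub S n n).lift k = Sub.id (n + k) := by
  induction k with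
  | zero => rfl
  | succ k ih =>
    funext i
    refine Fin.cases rfl (fun i => ?_) i
    simp only [Sub.lift, ih, Fin.cons_succ]
    rfl

theorem Exp.subst_id {n : ℕ} (e : Exp S n) : e.subst (Sub.id n) = e := by
  induction e with
  | var i => rfl
  | op o args ih =>
    simp only [Exp.subst, Sub.lift_id]
    congr 1
    funext i
    exact ih i

theorem Exp.ren_eq_subst {n m : ℕ} (e : Exp S n) (ρ : Fin n → Fin m) :
    e.ren ρ = e.subst (fun i => .var (ρ i)) := by
  rw [← Exp.subst_id (e.ren ρ), Exp.ren_subst]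
  rfl

theorem Exp.wk_eq_ren {n : ℕ} (e : Exp S n) : e.wk = e.ren Fin.succ := by
  rw [Exp.ren_eq_subst]; rfl

theorem Sub.comp_assoc {n m l k : ℕ} (σ : Sub S n m) (τ : Sub S m l) (υ : Sub S l k) :
    (σ.comp τ).comp υ = σ.comp (τ.comp υ) := by
  funext i; exact Exp.subst_subst _ _ _

theorem Sub.id_comp {n m : ℕ} (σ : Sub S n m) : (Sub.id n).comp σ = σ := rfl

theorem Sub.comp_id {n m : ℕ} (σ : Sub S n m) : σ.comp (Sub.id m) = σ := by
  funext i; exact Exp.subst_id _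

end RawLemmas

/-! ## Contexts, dependent contexts, judgements -/

/-- Raw contexts `(x₀ ∈ A₀, …, xₙ₋₁ ∈ Aₙ₋₁)`. -/
inductive Ctx (S : Signature.{u}) : ℕ → Type u
  | nil : Ctx S 0
  | snoc {n : ℕ} (Γ : Ctx S n) (A : Exp S n) : Ctx S (n + 1)

/-- Raw dependent contexts of length `k`, relative to a context of length `n`. -/
inductive Tel (S : Signature.{u}) (n : ℕ) : ℕ → Type u
  | nil : Tel S n 0
  | snoc {k : ℕ} (Δ : Tel S n k) (A : Exp S (n + k)) : Tel S n (k + 1)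

/-- The concatenation `(Γ, Δ)`. -/
def Ctx.append {n : ℕ} (Γ : Ctx S n) : {k : ℕ} → Tel S n k → Ctx S (n + k)
  | _, .nil => Γ
  | _, .snoc Δ A => .snoc (Γ.append Δ) A

def Tel.subst {n m : ℕ} (σ : Sub S n m) : {k : ℕ} → Tel S n k → Tel S m k
  | _, .nil => .nil
  | _, .snoc (k := k) Δ A => .snoc (Δ.subst σ) (A.subst (σ.lift k))

/-- The four forms of judgement: `A ∈ Type`, `a ∈ A`, `A = B ∈ Type`, `a = b ∈ A`. -/
inductive Judgement (S : Signature.{u}) (n : ℕ) : Type u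
  | isType (A : Exp S n)
  | mem (a A : Exp S n)
  | typeEq (A B : Exp S n)
  | memEq (a b A : Exp S n)

def Judgement.subst {n m : ℕ} (σ : Sub S n m) : Judgement S n → Judgement S m
  | .isType A => .isType (A.subst σ)
  | .mem a A => .mem (a.subst σ) (A.subst σ)
  | .typeEq A B => .typeEq (A.subst σ) (B.subst σ)
  | .memEq a b A => .memEq (a.subst σ) (b.subst σ) (A.subst σ)

section

variable (D : {n : ℕ} → Ctx S n → Judgement S n → Prop)

/-- Well-formedness of a context, where `D` is the set of derivable judgements `(Γ) 𝒥`. -/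
def WellFormed : {n : ℕ} → Ctx S n → Prop
  | _, .nil => True
  | _, .snoc Γ A => WellFormed Γ ∧ D Γ (.isType A)

/-- `f = (b₀, …, bₘ₋₁)` is a context morphism `Φ → Ψ`: the judgements
`(Φ) bᵢ ∈ Bᵢ(b₀, …, bᵢ₋₁)` are derivable. -/
def IsMor {n : ℕ} (Φ : Ctx S n) : {m : ℕ} → (Ψ : Ctx S m) → Sub S m n → Prop
  | _, .nil, _ => True
  | _, .snoc Ψ B, f => IsMor Φ Ψ (Fin.tail f) ∧ D Φ (.mem (f 0) (B.subst (Fin.tail f)))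

/-- Pointwise definitional equality of `f` and `g` from `Φ` to `Ψ`: the judgements
`(Φ) bᵢ = cᵢ ∈ Bᵢ(b₀, …, bᵢ₋₁)` are derivable. -/
def MorEq {n : ℕ} (Φ : Ctx S n) : {m : ℕ} → (Ψ : Ctx S m) → Sub S m n → Sub S m n → Prop
  | _, .nil, _, _ => True
  | _, .snoc Ψ B, f, g => MorEq Φ Ψ (Fin.tail f) (Fin.tail g) ∧
      D Φ (.memEq (f 0) (g 0) (B.subst (Fin.tail f)))

/-- Componentwise definitional equality of contexts. -/
def CtxEq : {n : ℕ} → Ctx S n → Ctx S n → Prop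
  | _, .nil, .nil => True
  | _, .snoc Γ A, .snoc Γ' A' => CtxEq Γ Γ' ∧ D Γ (.typeEq A A')

end

/-- A dependent type theory over the signature `S`: a set of derivable judgements closed under the
structural rules. -/
structure Theory (S : Signature.{u}) where
  /-- `(Γ) 𝒥` is derivable -/
  Der : {n : ℕ} → Ctx S n → Judgement S n → Prop
  /- Presuppositions: judgements are only made about well-formed contexts, types and elements. -/
  wf_of_der {n : ℕ} {Γ : Ctx S n} {𝒥 : Judgement S n} : Der Γ 𝒥 → WellFormed Der Γ
  isType_of_mem {n : ℕ} {Γ : Ctx S n} {a A : Exp S n} : Der Γ (.mem a A) → Der Γ (.isType A)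
  isType_of_typeEq {n : ℕ} {Γ : Ctx S n} {A B : Exp S n} :
    Der Γ (.typeEq A B) → Der Γ (.isType A) ∧ Der Γ (.isType B)
  mem_of_memEq {n : ℕ} {Γ : Ctx S n} {a b A : Exp S n} :
    Der Γ (.memEq a b A) → Der Γ (.mem a A) ∧ Der Γ (.mem b A)
  /- Axiom, weakening and substitution. -/
  ax {n : ℕ} {Γ : Ctx S n} {A : Exp S n} :
    Der Γ (.isType A) → Der (Γ.snoc A) (.mem (.var 0) A.wk)
  weakening {n k : ℕ} {Γ : Ctx S n} {Δ : Tel S n k} {𝒥 : Judgement S (n + k)} {A : Exp S n} :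
    Der (Γ.append Δ) 𝒥 → Der Γ (.isType A) →
      Der ((Γ.snoc A).append (Δ.subst (Sub.wk n 1))) (𝒥.subst ((Sub.wk n 1).lift k))
  substitution {n k : ℕ} {Γ : Ctx S n} {A : Exp S n} {Δ : Tel S (n + 1) k}
      {𝒥 : Judgement S (n + 1 + k)} {a : Exp S n} :
    Der ((Γ.snoc A).append Δ) 𝒥 → Der Γ (.mem a A) →
      Der (Γ.append (Δ.subst (Sub.inst a))) (𝒥.subst ((Sub.inst a).lift k))
  /- Substitution of definitionally equal elements gives definitionally equal results. -/
  subst_typeEq {n m : ℕ} {Φ : Ctx S n} {Ψ : Ctx S m} {f g : Sub S m n} {B : Exp S m} :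
    WellFormed Der Φ → IsMor Der Φ Ψ f → IsMor Der Φ Ψ g → MorEq Der Φ Ψ f g →
      Der Ψ (.isType B) → Der Φ (.typeEq (B.subst f) (B.subst g))
  subst_memEq {n m : ℕ} {Φ : Ctx S n} {Ψ : Ctx S m} {f g : Sub S m n} {b B : Exp S m} :
    WellFormed Der Φ → IsMor Der Φ Ψ f → IsMor Der Φ Ψ g → MorEq Der Φ Ψ f g →
      Der Ψ (.mem b B) → Der Φ (.memEq (b.subst f) (b.subst g) (B.subst f))
  /- Definitional equality of types. -/
  type_refl {n : ℕ} {Γ : Ctx S n} {A : Exp S n} : Der Γ (.isType A) → Der Γ (.typeEq A A)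
  type_symm {n : ℕ} {Γ : Ctx S n} {A B : Exp S n} : Der Γ (.typeEq A B) → Der Γ (.typeEq B A)
  type_trans {n : ℕ} {Γ : Ctx S n} {A B C : Exp S n} :
    Der Γ (.typeEq A B) → Der Γ (.typeEq B C) → Der Γ (.typeEq A C)
  /- Definitional equality of elements. -/
  refl {n : ℕ} {Γ : Ctx S n} {a A : Exp S n} : Der Γ (.mem a A) → Der Γ (.memEq a a A)
  symm {n : ℕ} {Γ : Ctx S n} {a b A : Exp S n} : Der Γ (.memEq a b A) → Der Γ (.memEq b a A)
  trans {n : ℕ} {Γ : Ctx S n} {a b c A : Exp S n} :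
    Der Γ (.memEq a b A) → Der Γ (.memEq b c A) → Der Γ (.memEq a c A)
  /- Compatibility. -/
  conv {n : ℕ} {Γ : Ctx S n} {a A B : Exp S n} :
    Der Γ (.mem a A) → Der Γ (.typeEq A B) → Der Γ (.mem a B)
  conv_eq {n : ℕ} {Γ : Ctx S n} {a b A B : Exp S n} :
    Der Γ (.memEq a b A) → Der Γ (.typeEq A B) → Der Γ (.memEq a b B)

/-! ## Identity types -/

/-- `(a, b, p)` substituted for the last three variables `x, y, u`. -/
def Sub.inst₃ {n : ℕ} (a b p : Exp S n) : Sub S (n + 3) n :=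
  Fin.cons p (Fin.cons b (Fin.cons a (Sub.id n)))

/-- The axioms for identity types in a dependent type theory `T`: expressions `Id A a b`, `r A a`
and `J A Θ C a b p d` (which may depend on all the data that occur in the rules), subject to the
formation, introduction, elimination and computation rules, relative to an arbitrary context `Γ`
and with an arbitrary dependent context `Θ(x, y, u)` of parameters, and commuting with
substitution. -/
structure IdentityTypes (T : Theory S) where
  Id : {n : ℕ} → (A a b : Exp S n) → Exp S n
  r : {n : ℕ} → (A a : Exp S n) → Exp S n
  J : {n k : ℕ} → (A : Exp S n) → (Θ : Tel S (n + 3) k) → (C : Exp S (n + 3 + k)) →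
    (a b p : Exp S n) → (d : Exp S (n + 1 + k)) → Exp S (n + k)
  formation {n : ℕ} {Γ : Ctx S n} {A a b : Exp S n} :
    T.Der Γ (.isType A) → T.Der Γ (.mem a A) → T.Der Γ (.mem b A) →
      T.Der Γ (.isType (Id A a b))
  introduction {n : ℕ} {Γ : Ctx S n} {A a : Exp S n} :
    T.Der Γ (.mem a A) → T.Der Γ (.mem (r A a) (Id A a a))
  elimination {n k : ℕ} {Γ : Ctx S n} {A a b p : Exp S n} {Θ : Tel S (n + 3) k}
      {C : Exp S (n + 3 + k)} {d : Exp S (n + 1 + k)} :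
    T.Der Γ (.mem a A) → T.Der Γ (.mem b A) → T.Der Γ (.mem p (Id A a b)) →
    -- `(x ∈ A, y ∈ A, u ∈ Id(x, y), Θ(x, y, u)) C(x, y, u) ∈ Type`
    T.Der ((((Γ.snoc A).snoc A.wk).snoc (Id A.wk.wk (.var 1) (.var 0))).append Θ) (.isType C) →
    -- `(x ∈ A, Θ(x, x, r(x))) d(x) ∈ C(x, x, r(x))`
    T.Der ((Γ.snoc A).append (Θ.subst
        (Fin.cons (r A.wk (.var 0)) (Fin.cons (.var 0) (Sub.id (n + 1))))))
      (.mem d (C.subst (Sub.lift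
        (Fin.cons (r A.wk (.var 0)) (Fin.cons (.var 0) (Sub.id (n + 1)))) k))) →
    T.Der (Γ.append (Θ.subst (Sub.inst₃ a b p)))
      (.mem (J A Θ C a b p d) (C.subst ((Sub.inst₃ a b p).lift k)))
  computation {n k : ℕ} {Γ : Ctx S n} {A a : Exp S n} {Θ : Tel S (n + 3) k}
      {C : Exp S (n + 3 + k)} {d : Exp S (n + 1 + k)} :
    T.Der Γ (.mem a A) →
    T.Der ((((Γ.snoc A).snoc A.wk).snoc (Id A.wk.wk (.var 1) (.var 0))).append Θ) (.isType C) →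
    T.Der ((Γ.snoc A).append (Θ.subst
        (Fin.cons (r A.wk (.var 0)) (Fin.cons (.var 0) (Sub.id (n + 1))))))
      (.mem d (C.subst (Sub.lift
        (Fin.cons (r A.wk (.var 0)) (Fin.cons (.var 0) (Sub.id (n + 1)))) k))) →
    T.Der (Γ.append (Θ.subst (Sub.inst₃ a a (r A a))))
      (.memEq (J A Θ C a a (r A a) d) (d.subst ((Sub.inst a).lift k))
        (C.subst ((Sub.inst₃ a a (r A a)).lift k)))
  Id_subst {n m : ℕ} {Γ : Ctx S n} {Γ' : Ctx S m} {σ : Sub S n m} {A a b : Exp S n} :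
    WellFormed T.Der Γ' → IsMor T.Der Γ' Γ σ → T.Der Γ (.mem a A) → T.Der Γ (.mem b A) →
      T.Der Γ' (.typeEq ((Id A a b).subst σ) (Id (A.subst σ) (a.subst σ) (b.subst σ)))
  r_subst {n m : ℕ} {Γ : Ctx S n} {Γ' : Ctx S m} {σ : Sub S n m} {A a : Exp S n} :
    WellFormed T.Der Γ' → IsMor T.Der Γ' Γ σ → T.Der Γ (.mem a A) →
      T.Der Γ' (.memEq ((r A a).subst σ) (r (A.subst σ) (a.subst σ))
        (Id (A.subst σ) (a.subst σ) (a.subst σ)))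
  J_subst {n m k : ℕ} {Γ : Ctx S n} {Γ' : Ctx S m} {σ : Sub S n m} {A a b p : Exp S n}
      {Θ : Tel S (n + 3) k} {C : Exp S (n + 3 + k)} {d : Exp S (n + 1 + k)} :
    WellFormed T.Der Γ' → IsMor T.Der Γ' Γ σ →
    T.Der Γ (.mem a A) → T.Der Γ (.mem b A) → T.Der Γ (.mem p (Id A a b)) →
    T.Der ((((Γ.snoc A).snoc A.wk).snoc (Id A.wk.wk (.var 1) (.var 0))).append Θ) (.isType C) →
    T.Der ((Γ.snoc A).append (Θ.subst
        (Fin.cons (r A.wk (.var 0)) (Fin.cons (.var 0) (Sub.id (n + 1))))))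
      (.mem d (C.subst (Sub.lift
        (Fin.cons (r A.wk (.var 0)) (Fin.cons (.var 0) (Sub.id (n + 1)))) k))) →
    T.Der (Γ'.append ((Θ.subst (Sub.inst₃ a b p)).subst σ))
      (.memEq ((J A Θ C a b p d).subst (σ.lift k))
        (J (A.subst σ) (Θ.subst (σ.lift 3)) (C.subst ((σ.lift 3).lift k))
          (a.subst σ) (b.subst σ) (p.subst σ) (d.subst ((σ.lift 1).lift k)))
        ((C.subst ((Sub.inst₃ a b p).lift k)).subst (σ.lift k)))

/-! ## Admissibility of simultaneous substitution -/

/-- `Over Γ Γ' σ Θ Θ' τ`: the context `Θ` extends `Γ`, the context `Θ'` is its reindexing along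
`σ`, extending `Γ'`, and `τ` is the corresponding lift of `σ`. -/
inductive Over {n m : ℕ} (Γ : Ctx S n) (Γ' : Ctx S m) (σ : Sub S n m) :
    {N M : ℕ} → Ctx S N → Ctx S M → Sub S N M → Prop
  | base : Over Γ Γ' σ Γ Γ' σ
  | snoc {N M : ℕ} {Θ : Ctx S N} {Θ' : Ctx S M} {τ : Sub S N M} (A : Exp S N) :
      Over Γ Γ' σ Θ Θ' τ → Over Γ Γ' σ (Θ.snoc A) (Θ'.snoc (A.subst τ)) (τ.lift 1)

theorem Over.exists_tel {n m : ℕ} {Γ : Ctx S n} {Γ' : Ctx S m} {σ : Sub S n m} {N M : ℕ}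
    {Θ : Ctx S N} {Θ' : Ctx S M} {τ : Sub S N M} (h : Over Γ Γ' σ Θ Θ' τ)
    (P : {N M : ℕ} → Ctx S N → Ctx S M → Sub S N M → Prop)
    (hP : ∀ (k : ℕ) (Ξ : Tel S n k), P (Γ.append Ξ) (Γ'.append (Ξ.subst σ)) (σ.lift k)) :
    P Θ Θ' τ := by
  induction h generalizing P with
  | base => exact hP 0 .nil
  | snoc A h ih =>
    exact ih (fun {N M} Θ Θ' τ => ∀ A : Exp S N, P (Θ.snoc A) (Θ'.snoc (A.subst τ)) (τ.lift 1))
      (fun k Ξ A => hP (k + 1) (.snoc Ξ A)) A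

theorem Over.trans {n m n₁ m₁ : ℕ} {Γ : Ctx S n} {Γ' : Ctx S m} {σ : Sub S n m}
    {Γ₁ : Ctx S n₁} {Γ₁' : Ctx S m₁} {σ₁ : Sub S n₁ m₁} {N M : ℕ}
    {Θ : Ctx S N} {Θ' : Ctx S M} {τ : Sub S N M} (h₁ : Over Γ Γ' σ Γ₁ Γ₁' σ₁)
    (h : Over Γ₁ Γ₁' σ₁ Θ Θ' τ) : Over Γ Γ' σ Θ Θ' τ := by
  induction h with
  | base => exact h₁
  | snoc A h ih => exact .snoc A ih

theorem Over.factor {n m l : ℕ} {Γ : Ctx S n} (Γ₁ : Ctx S m) {Γ₂ : Ctx S l} (σ₁ : Sub S n m)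
    (σ₂ : Sub S m l) {σ : Sub S n l} (hσ : σ = σ₁.comp σ₂) {N M : ℕ} {Θ : Ctx S N} {Θ' : Ctx S M}
    {τ : Sub S N M} (h : Over Γ Γ₂ σ Θ Θ' τ) :
    ∃ (L : ℕ) (Θ₁ : Ctx S L) (τ₁ : Sub S N L) (τ₂ : Sub S L M),
      Over Γ Γ₁ σ₁ Θ Θ₁ τ₁ ∧ Over Γ₁ Γ₂ σ₂ Θ₁ Θ' τ₂ ∧ τ = τ₁.comp τ₂ := by
  subst hσ
  induction h with
  | base => exact ⟨_, _, _, _, .base, .base, rfl⟩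
  | snoc A h ih =>
    obtain ⟨L, Θ₁, τ₁, τ₂, h₁, h₂, rfl⟩ := ih
    refine ⟨_, _, _, _, .snoc A h₁, ?_, Sub.lift_comp _ _ 1⟩
    rw [← Exp.subst_subst]
    exact .snoc _ h₂

theorem Judgement.subst_subst {n m l : ℕ} (𝒥 : Judgement S n) (σ : Sub S n m) (τ : Sub S m l) :
    (𝒥.subst σ).subst τ = 𝒥.subst (σ.comp τ) := by
  cases 𝒥 <;> simp [Judgement.subst, Exp.subst_subst]

theorem Judgement.subst_id {n : ℕ} (𝒥 : Judgement S n) : 𝒥.subst (Sub.id n) = 𝒥 := by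
  cases 𝒥 <;> simp [Judgement.subst, Exp.subst_id]

theorem Sub.lift_one_comp_inst {n m : ℕ} (σ : Sub S (n + 1) m) :
    (Sub.lift (Fin.tail σ) 1).comp (Sub.inst (σ 0)) = σ := by
  funext i
  refine Fin.cases rfl (fun i => ?_) i
  simp only [Sub.comp, Sub.lift, Fin.cons_succ, Exp.ren_subst]
  exact Exp.subst_id _

theorem Exp.wk_subst {n m : ℕ} (A : Exp S n) (σ : Sub S (n + 1) m) :
    A.wk.subst σ = A.subst (Fin.tail σ) := by
  rw [Exp.wk, Exp.subst_subst]; rfl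

namespace Theory

variable (T : Theory S)

/-- Well-formed contexts of `T`. -/
abbrev WF {n : ℕ} (Γ : Ctx S n) : Prop := WellFormed T.Der Γ

theorem der_over_wk {n : ℕ} {Γ : Ctx S n} {A : Exp S n} (hA : T.Der Γ (.isType A)) {N M : ℕ}
    {Θ : Ctx S N} {Θ' : Ctx S M} {τ : Sub S N M} (h : Over Γ (Γ.snoc A) (Sub.wk n 1) Θ Θ' τ)
    {𝒥 : Judgement S N} (h𝒥 : T.Der Θ 𝒥) : T.Der Θ' (𝒥.subst τ) :=
  h.exists_tel (fun {N _} Θ Θ' τ => ∀ 𝒥 : Judgement S N, T.Der Θ 𝒥 → T.Der Θ' (𝒥.subst τ))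
    (fun _ _ _ h𝒥 => T.weakening h𝒥 hA) 𝒥 h𝒥

theorem der_over_inst {n : ℕ} {Γ : Ctx S n} {a A : Exp S n} (ha : T.Der Γ (.mem a A)) {N M : ℕ}
    {Θ : Ctx S N} {Θ' : Ctx S M} {τ : Sub S N M} (h : Over (Γ.snoc A) Γ (Sub.inst a) Θ Θ' τ)
    {𝒥 : Judgement S N} (h𝒥 : T.Der Θ 𝒥) : T.Der Θ' (𝒥.subst τ) :=
  h.exists_tel (fun {N _} Θ Θ' τ => ∀ 𝒥 : Judgement S N, T.Der Θ 𝒥 → T.Der Θ' (𝒥.subst τ))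
    (fun _ _ _ h𝒥 => T.substitution h𝒥 ha) 𝒥 h𝒥

theorem over_refl {n : ℕ} {Γ : Ctx S n} {N M : ℕ} {Θ : Ctx S N} {Θ' : Ctx S M} {τ : Sub S N M}
    (h : Over Γ Γ (Sub.id n) Θ Θ' τ) {𝒥 : Judgement S N} (h𝒥 : T.Der Θ 𝒥) :
    T.Der Θ' (𝒥.subst τ) := by
  suffices ∃ _ : N = M, Θ ≍ Θ' ∧ τ ≍ (Sub.id N : Sub S N N) by
    obtain ⟨rfl, h₁, h₂⟩ := this
    obtain rfl := eq_of_heq h₁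
    obtain rfl := eq_of_heq h₂
    rwa [Judgement.subst_id]
  clear h𝒥 𝒥
  induction h with
  | base => exact ⟨rfl, HEq.rfl, HEq.rfl⟩
  | snoc A h ih =>
    obtain ⟨rfl, h₁, h₂⟩ := ih
    obtain rfl := eq_of_heq h₁
    obtain rfl := eq_of_heq h₂
    refine ⟨rfl, ?_, ?_⟩
    · rw [Exp.subst_id]
    · rw [Sub.lift_id]

theorem der_over {n m : ℕ} {Γ : Ctx S n} {Γ' : Ctx S m} {σ : Sub S n m} (hΓ' : T.WF Γ')
    (hσ : IsMor T.Der Γ' Γ σ) {N M : ℕ} {Θ : Ctx S N} {Θ' : Ctx S M} {τ : Sub S N M}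
    (h : Over Γ Γ' σ Θ Θ' τ) {𝒥 : Judgement S N} (h𝒥 : T.Der Θ 𝒥) : T.Der Θ' (𝒥.subst τ) := by
  induction Γ generalizing N M with
  | nil =>
    induction Γ' generalizing N M with
    | nil =>
      obtain rfl : σ = Sub.id 0 := funext fun i => i.elim0
      exact T.over_refl h h𝒥
    | snoc Γ' A ih =>
      obtain ⟨L, Θ₁, τ₁, τ₂, h₁, h₂, rfl⟩ := h.factor Γ' (fun i => i.elim0) (Sub.wk _ 1)
        (funext fun i => i.elim0)
      rw [← Judgement.subst_subst]
      exact T.der_over_wk hΓ'.2 h₂ (ih hΓ'.1 trivial h₁ h𝒥)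
  | snoc Γ A ih =>
    obtain ⟨L, Θ₁, τ₁, τ₂, h₁, h₂, rfl⟩ := h.factor (Γ'.snoc (A.subst (Fin.tail σ)))
      (Sub.lift (Fin.tail σ) 1) (Sub.inst (σ 0)) (Sub.lift_one_comp_inst σ).symm
    rw [← Judgement.subst_subst]
    exact T.der_over_inst hσ.2 h₂ (ih hσ.1 (Over.trans (.snoc A .base) h₁) h𝒥)

/-- Derivable judgements are stable under substitution along context morphisms. -/
theorem der_subst {n m : ℕ} {Γ : Ctx S n} {Γ' : Ctx S m} {σ : Sub S n m} (hΓ' : T.WF Γ')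
    (hσ : IsMor T.Der Γ' Γ σ) {𝒥 : Judgement S n} (h𝒥 : T.Der Γ 𝒥) : T.Der Γ' (𝒥.subst σ) :=
  T.der_over hΓ' hσ .base h𝒥

variable {T}

theorem isMor_comp {n m l : ℕ} {Γ : Ctx S n} {Δ : Ctx S m} {Ξ : Ctx S l} {σ : Sub S m n}
    {τ : Sub S l m} (hΓ : T.WF Γ) (hσ : IsMor T.Der Γ Δ σ) (hτ : IsMor T.Der Δ Ξ τ) :
    IsMor T.Der Γ Ξ (τ.comp σ) := by
  induction Ξ with
  | nil => trivial
  | snoc Ξ A ih =>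
    refine ⟨ih hτ.1, ?_⟩
    have := T.der_subst hΓ hσ hτ.2
    rw [Judgement.subst, Exp.subst_subst] at this
    exact this

theorem isMor_wk {n l : ℕ} {Γ : Ctx S n} {A : Exp S n} {Ξ : Ctx S l} {σ : Sub S l n}
    (hA : T.Der Γ (.isType A)) (hσ : IsMor T.Der Γ Ξ σ) :
    IsMor T.Der (Γ.snoc A) Ξ (σ.comp (Sub.wk n 1)) := by
  induction Ξ with
  | nil => trivial
  | snoc Ξ B ih =>
    refine ⟨ih hσ.1, ?_⟩
    have := T.der_over_wk hA .base hσ.2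
    rw [Judgement.subst, Exp.subst_subst] at this
    exact this

/-- The identity is a context morphism between definitionally equal contexts. -/
theorem isMor_id_of_ctxEq {n : ℕ} {Γ Γ' : Ctx S n} (hΓ : T.WF Γ) (hΓ' : T.WF Γ')
    (h : CtxEq T.Der Γ Γ') :
    IsMor T.Der Γ Γ' (Sub.id n) ∧ IsMor T.Der Γ' Γ (Sub.id n) := by
  induction Γ with
  | nil => cases Γ'; exact ⟨trivial, trivial⟩
  | snoc Γ A ih =>
    cases Γ' with
    | snoc Γ' A' =>
      obtain ⟨h₁, h₂⟩ := ih hΓ.1 hΓ'.1 h.1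
      have e := h.2
      have e' := T.der_subst hΓ'.1 h₂ e
      rw [Judgement.subst_id] at e'
      refine ⟨⟨isMor_wk hΓ.2 h₁, ?_⟩, ⟨isMor_wk hΓ'.2 h₂, ?_⟩⟩
      · exact T.conv (T.ax hΓ.2) (T.der_over_wk hΓ.2 .base e)
      · exact T.conv (T.ax hΓ'.2) (T.der_over_wk hΓ'.2 .base (T.type_symm e'))

theorem ctxEq_refl {n : ℕ} {Γ : Ctx S n} (hΓ : T.WF Γ) : CtxEq T.Der Γ Γ := by
  induction Γ with
  | nil => trivial
  | snoc Γ A ih => exact ⟨ih hΓ.1, T.type_refl hΓ.2⟩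

theorem isMor_id {n : ℕ} {Γ : Ctx S n} (hΓ : T.WF Γ) : IsMor T.Der Γ Γ (Sub.id n) :=
  (isMor_id_of_ctxEq hΓ hΓ (ctxEq_refl hΓ)).1

/-- Derivability is invariant under definitional equality of contexts. -/
theorem der_of_ctxEq {n : ℕ} {Γ Γ' : Ctx S n} (hΓ : T.WF Γ) (hΓ' : T.WF Γ')
    (h : CtxEq T.Der Γ Γ') {𝒥 : Judgement S n} : T.Der Γ 𝒥 ↔ T.Der Γ' 𝒥 := by
  obtain ⟨h₁, h₂⟩ := isMor_id_of_ctxEq hΓ hΓ' h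
  constructor <;> intro h𝒥
  · simpa only [Judgement.subst_id] using T.der_subst hΓ' h₂ h𝒥
  · simpa only [Judgement.subst_id] using T.der_subst hΓ h₁ h𝒥

theorem ctxEq_symm {n : ℕ} {Γ Γ' : Ctx S n} (hΓ : T.WF Γ) (hΓ' : T.WF Γ')
    (h : CtxEq T.Der Γ Γ') : CtxEq T.Der Γ' Γ := by
  induction Γ with
  | nil => cases Γ'; trivial
  | snoc Γ A ih =>
    cases Γ' with
    | snoc Γ' A' =>
      exact ⟨ih hΓ.1 hΓ'.1 h.1, T.type_symm ((der_of_ctxEq hΓ.1 hΓ'.1 h.1).1 h.2)⟩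

theorem ctxEq_trans {n : ℕ} {Γ Γ' Γ'' : Ctx S n} (hΓ : T.WF Γ) (hΓ' : T.WF Γ')
    (h : CtxEq T.Der Γ Γ') (h' : CtxEq T.Der Γ' Γ'') : CtxEq T.Der Γ Γ'' := by
  induction Γ with
  | nil => cases Γ'; exact h'
  | snoc Γ A ih =>
    cases Γ' with
    | snoc Γ' A' =>
      cases Γ'' with
      | snoc Γ'' A'' =>
        exact ⟨ih hΓ.1 hΓ'.1 h.1 h'.1,
          T.type_trans h.2 ((der_of_ctxEq hΓ.1 hΓ'.1 h.1).2 h'.2)⟩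

theorem isMor_of_ctxEq {n m : ℕ} {Φ Φ' : Ctx S n} {Ψ Ψ' : Ctx S m} (hΦ : T.WF Φ)
    (hΦ' : T.WF Φ') (hΨ : T.WF Ψ) (hΨ' : T.WF Ψ') (e : CtxEq T.Der Φ Φ') (e' : CtxEq T.Der Ψ Ψ')
    {f : Sub S m n} (hf : IsMor T.Der Φ Ψ f) : IsMor T.Der Φ' Ψ' f := by
  have h := isMor_comp hΦ' (isMor_id_of_ctxEq hΦ hΦ' e).2
    (isMor_comp hΦ hf (isMor_id_of_ctxEq hΨ hΨ' e').1)
  rwa [Sub.id_comp, Sub.comp_id] at h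

theorem morEq_refl {n m : ℕ} {Φ : Ctx S n} {Ψ : Ctx S m} {f : Sub S m n}
    (hf : IsMor T.Der Φ Ψ f) : MorEq T.Der Φ Ψ f f := by
  induction Ψ with
  | nil => trivial
  | snoc Ψ B ih => exact ⟨ih hf.1, T.refl hf.2⟩

theorem morEq_symm {n m : ℕ} {Φ : Ctx S n} {Ψ : Ctx S m} (hΦ : T.WF Φ) (hΨ : T.WF Ψ)
    {f g : Sub S m n} (hf : IsMor T.Der Φ Ψ f) (hg : IsMor T.Der Φ Ψ g)
    (h : MorEq T.Der Φ Ψ f g) : MorEq T.Der Φ Ψ g f := by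
  induction Ψ with
  | nil => trivial
  | snoc Ψ B ih =>
    exact ⟨ih hΨ.1 hf.1 hg.1 h.1,
      T.conv_eq (T.symm h.2) (T.subst_typeEq hΦ hf.1 hg.1 h.1 hΨ.2)⟩

theorem morEq_trans {n m : ℕ} {Φ : Ctx S n} {Ψ : Ctx S m} (hΦ : T.WF Φ) (hΨ : T.WF Ψ)
    {f g k : Sub S m n} (hf : IsMor T.Der Φ Ψ f) (hg : IsMor T.Der Φ Ψ g)
    (h : MorEq T.Der Φ Ψ f g) (h' : MorEq T.Der Φ Ψ g k) : MorEq T.Der Φ Ψ f k := by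
  induction Ψ with
  | nil => trivial
  | snoc Ψ B ih =>
    exact ⟨ih hΨ.1 hf.1 hg.1 h.1 h'.1,
      T.trans h.2 (T.conv_eq h'.2 (T.type_symm (T.subst_typeEq hΦ hf.1 hg.1 h.1 hΨ.2)))⟩

theorem morEq_comp_left {n m l : ℕ} {Γ : Ctx S n} {Δ : Ctx S m} {Ξ : Ctx S l} {σ : Sub S m n}
    {τ τ' : Sub S l m} (hΓ : T.WF Γ) (hσ : IsMor T.Der Γ Δ σ) (h : MorEq T.Der Δ Ξ τ τ') :
    MorEq T.Der Γ Ξ (τ.comp σ) (τ'.comp σ) := by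
  induction Ξ with
  | nil => trivial
  | snoc Ξ A ih =>
    refine ⟨ih h.1, ?_⟩
    have := T.der_subst hΓ hσ h.2
    rw [Judgement.subst, Exp.subst_subst] at this
    exact this

theorem morEq_comp_right {n m l : ℕ} {Γ : Ctx S n} {Δ : Ctx S m} {Ξ : Ctx S l}
    {σ σ' : Sub S m n} {τ : Sub S l m} (hΓ : T.WF Γ) (hσ : IsMor T.Der Γ Δ σ)
    (hσ' : IsMor T.Der Γ Δ σ') (h : MorEq T.Der Γ Δ σ σ') (hτ : IsMor T.Der Δ Ξ τ) :
    MorEq T.Der Γ Ξ (τ.comp σ) (τ.comp σ') := by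
  induction Ξ with
  | nil => trivial
  | snoc Ξ A ih =>
    refine ⟨ih hτ.1, ?_⟩
    have := T.subst_memEq hΓ hσ hσ' h hτ.2
    rw [Exp.subst_subst] at this
    exact this

theorem morEq_of_ctxEq {n m : ℕ} {Φ Φ' : Ctx S n} {Ψ Ψ' : Ctx S m} (hΦ : T.WF Φ)
    (hΦ' : T.WF Φ') (hΨ : T.WF Ψ) (hΨ' : T.WF Ψ') (e : CtxEq T.Der Φ Φ') (e' : CtxEq T.Der Ψ Ψ')
    {f g : Sub S m n} (hf : IsMor T.Der Φ Ψ f) (hg : IsMor T.Der Φ Ψ g)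
    (h : MorEq T.Der Φ Ψ f g) : MorEq T.Der Φ' Ψ' f g := by
  have h₁ := morEq_comp_right hΦ hf hg h (isMor_id_of_ctxEq hΨ hΨ' e').1
  have h₂ := morEq_comp_left hΦ' (isMor_id_of_ctxEq hΦ hΦ' e).2 h₁
  rwa [Sub.id_comp, Sub.id_comp, Sub.comp_id, Sub.comp_id] at h₂

/-! ## The classifying category -/

variable (T)

/-- Well-formed contexts of length `n`, up to componentwise definitional equality. -/
def ctxSetoid (n : ℕ) : Setoid {Γ : Ctx S n // T.WF Γ} where
  r Γ Γ' := CtxEq T.Der Γ.1 Γ'.1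
  iseqv := ⟨fun Γ => ctxEq_refl Γ.2, fun {Γ Γ'} h => ctxEq_symm Γ.2 Γ'.2 h,
    fun {Γ Γ' _} h h' => ctxEq_trans Γ.2 Γ'.2 h h'⟩

/-- Objects of the classifying category of `T`: equivalence classes of contexts. -/
structure Cl where
  len : ℕ
  cls : Quotient (T.ctxSetoid len)

variable {T}

/-- The class of the context `Γ`. -/
def Cl.mk' {n : ℕ} (Γ : Ctx S n) (hΓ : T.WF Γ) : T.Cl := ⟨n, Quotient.mk _ ⟨Γ, hΓ⟩⟩

/-- `Γ` represents the object `X`. -/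
def Cl.Rep (X : T.Cl) (Γ : {Γ : Ctx S X.len // T.WF Γ}) : Prop :=
  Quotient.mk (T.ctxSetoid X.len) Γ = X.cls

theorem Cl.exists_rep (X : T.Cl) : ∃ Γ, X.Rep Γ := Quotient.exists_rep X.cls

theorem Cl.Rep.ctxEq {X : T.Cl} {Γ Γ' : {Γ : Ctx S X.len // T.WF Γ}} (h : X.Rep Γ)
    (h' : X.Rep Γ') : CtxEq T.Der Γ.1 Γ'.1 :=
  Quotient.exact (s := T.ctxSetoid X.len) (h.trans h'.symm)

/-- Context morphisms between (all, equivalently some, representatives of) two objects. -/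
def Cl.RawHom (X Y : T.Cl) : Type u :=
  {f : Sub S Y.len X.len // ∀ Φ Ψ, X.Rep Φ → Y.Rep Ψ → IsMor T.Der Φ.1 Ψ.1 f}

/-- Context morphisms up to pointwise definitional equality. -/
def Cl.homSetoid (X Y : T.Cl) : Setoid (X.RawHom Y) where
  r f g := ∀ Φ Ψ, X.Rep Φ → Y.Rep Ψ → MorEq T.Der Φ.1 Ψ.1 f.1 g.1
  iseqv := ⟨fun f Φ Ψ hΦ hΨ => morEq_refl (f.2 Φ Ψ hΦ hΨ),
    fun {f g} h Φ Ψ hΦ hΨ =>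
      morEq_symm Φ.2 Ψ.2 (f.2 Φ Ψ hΦ hΨ) (g.2 Φ Ψ hΦ hΨ) (h Φ Ψ hΦ hΨ),
    fun {f g _} h h' Φ Ψ hΦ hΨ =>
      morEq_trans Φ.2 Ψ.2 (f.2 Φ Ψ hΦ hΨ) (g.2 Φ Ψ hΦ hΨ) (h Φ Ψ hΦ hΨ) (h' Φ Ψ hΦ hΨ)⟩

def Cl.RawHom.id (X : T.Cl) : X.RawHom X :=
  ⟨Sub.id X.len, fun Φ Ψ hΦ hΨ => (isMor_id_of_ctxEq Φ.2 Ψ.2 (hΦ.ctxEq hΨ)).1⟩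

/-- Composition of context morphisms, by substitution. -/
def Cl.RawHom.comp {X Y Z : T.Cl} (f : X.RawHom Y) (g : Y.RawHom Z) : X.RawHom Z :=
  ⟨g.1.comp f.1, fun Φ Ξ hΦ hΞ => by
    obtain ⟨Ψ, hΨ⟩ := Y.exists_rep
    exact isMor_comp Φ.2 (f.2 Φ Ψ hΦ hΨ) (g.2 Ψ Ξ hΨ hΞ)⟩

theorem Cl.RawHom.comp_congr {X Y Z : T.Cl} (f : X.RawHom Y) (g : Y.RawHom Z)
    (f' : X.RawHom Y) (g' : Y.RawHom Z) (hf : (X.homSetoid Y).r f f')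
    (hg : (Y.homSetoid Z).r g g') : (X.homSetoid Z).r (f.comp g) (f'.comp g') := by
  intro Φ Ξ hΦ hΞ
  obtain ⟨Ψ, hΨ⟩ := Y.exists_rep
  have h₁ := f.2 Φ Ψ hΦ hΨ
  have h₂ := f'.2 Φ Ψ hΦ hΨ
  exact morEq_trans Φ.2 Ξ.2 ((f.comp g).2 Φ Ξ hΦ hΞ) ((f.comp g').2 Φ Ξ hΦ hΞ)
    (morEq_comp_left Φ.2 h₁ (hg Ψ Ξ hΨ hΞ))
    (morEq_comp_right Φ.2 h₁ h₂ (hf Φ Ψ hΦ hΨ) (g'.2 Ψ Ξ hΨ hΞ))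

/-- The classifying category of `T`. -/
instance : CategoryTheory.Category.{u} T.Cl where
  Hom X Y := Quotient (X.homSetoid Y)
  id X := Quotient.mk _ (Cl.RawHom.id X)
  comp {X Y Z} := Quotient.map₂ (sa := X.homSetoid Y) (sb := Y.homSetoid Z) (sc := X.homSetoid Z)
    Cl.RawHom.comp (fun f f' hf g g' hg => Cl.RawHom.comp_congr f g f' g' hf hg)
  id_comp {X Y} f := by
    induction f using Quotient.inductionOn with
    | h f => exact congrArg (Quotient.mk _) (Subtype.ext (Sub.comp_id f.1))
  comp_id {X Y} f := by
    induction f using Quotient.inductionOn with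
    | h f => exact congrArg (Quotient.mk _) (Subtype.ext (Sub.id_comp f.1))
  assoc {W X Y Z} f g h := by
    induction f using Quotient.inductionOn with
    | h f =>
      induction g using Quotient.inductionOn with
      | h g =>
        induction h using Quotient.inductionOn with
        | h h => exact congrArg (Quotient.mk _) (Subtype.ext (Sub.comp_assoc h.1 g.1 f.1).symm)

/-- The map in the classifying category that is represented by a context morphism `f : Φ → Ψ`. -/
def Cl.homMk {n m : ℕ} {Φ : Ctx S n} {Ψ : Ctx S m} (hΦ : T.WF Φ) (hΨ : T.WF Ψ) (f : Sub S m n)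
    (hf : IsMor T.Der Φ Ψ f) : Cl.mk' Φ hΦ ⟶ Cl.mk' Ψ hΨ :=
  Quotient.mk ((Cl.mk' Φ hΦ).homSetoid (Cl.mk' Ψ hΨ))
    ⟨f, fun Φ' Ψ' hΦ' hΨ' => isMor_of_ctxEq hΦ Φ'.2 hΨ Ψ'.2
      (Quotient.exact (s := T.ctxSetoid n) hΦ'.symm)
      (Quotient.exact (s := T.ctxSetoid m) hΨ'.symm) hf⟩

theorem wf_of_append {n k : ℕ} {Γ : Ctx S n} {Δ : Tel S n k} (h : T.WF (Γ.append Δ)) :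
    T.WF Γ := by
  induction Δ with
  | nil => exact h
  | snoc Δ A ih => exact ih h.1

theorem isMor_proj {n k : ℕ} {Γ : Ctx S n} {Δ : Tel S n k} (h : T.WF (Γ.append Δ)) :
    IsMor T.Der (Γ.append Δ) Γ (Sub.wk n k) := by
  induction Δ with
  | nil => exact isMor_id h
  | snoc Δ A ih => exact isMor_wk h.2 (ih h.1)

/-- The dependent projection `(Γ, Δ) → Γ`. -/
def Cl.proj {n k : ℕ} (Γ : Ctx S n) (Δ : Tel S n k) (h : T.WF (Γ.append Δ)) :
    Cl.mk' (Γ.append Δ) h ⟶ Cl.mk' Γ (wf_of_append h) :=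
  Cl.homMk h (wf_of_append h) (Sub.wk n k) (isMor_proj h)

variable (T)

/-- The display maps `(Γ, x ∈ A) → Γ`. -/
inductive displayMaps : CategoryTheory.MorphismProperty T.Cl
  | mk {n : ℕ} (Γ : Ctx S n) (A : Exp S n) (h : T.WF (Γ.snoc A)) :
      displayMaps (Cl.homMk h h.1 (Sub.wk n 1) (isMor_wk h.2 (isMor_id h.1)))

/-- The dependent projections `(Γ, Δ) → Γ`. -/
inductive dependentProjections : CategoryTheory.MorphismProperty T.Cl
  | mk {n k : ℕ} (Γ : Ctx S n) (Δ : Tel S n k) (h : T.WF (Γ.append Δ)) :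
      dependentProjections (Cl.proj Γ Δ h)

end Theory

end TypeTheory

/-! Both orthogonality conditions are formal, so everything rests on the factorisation. Call
composites of isomorphisms and pullbacks of display maps fibrations; they lie in $\mathcal{B}$ and,
in $\mathcal{C}(\mathbb{T})$, are isomorphic to dependent projections. A map into $(\Psi, x \in B)$
is factored by induction on the length of the target, one type at a time, so that only identity
types of types are needed and never identity contexts.

In the induction step the composite to $\Psi$ factors as $g \circ i$. Lifting $i$ against the
pullback of the display map along $g$ reduces the problem to factoring a section $s$ of a display
map $p : E \to X$ (`exists_factorization_of_display`). The middle object is $Q = \{(e, u) : u \in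
\mathrm{Id}(s(p(e)), e)\}$, with $j(x) = (s(x), \mathrm{r}(s(x)))$
(`exists_factorization_of_section`).

That $j \in \mathcal{A}$ is based path induction, to be deduced from $\mathrm{J}$. For a type over
$Q$ with an element given along $j$, transport along $u$ yields an element over the path $\mathrm{r}
\cdot u$ instead of $u$, since concatenation is strictly unital on one side only
(`exists_partial_transport`). A homotopy from $\mathrm{r} \cdot u$ to $u$ that is constant at
$\mathrm{r}$ (`exists_homotopy`) allows a second transport, which lands over $u$ and changes nothing
along $j$ (`exists_transport`).

This argument needs only pullbacks of display maps and path objects whose reflexivity map is in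
$\mathcal{A}$ stably. In $\mathcal{C}(\mathbb{T})$ that stability is the elimination rule with its
parameters $\Theta$, together with the commutation of $\mathrm{Id}$, $\mathrm{r}$ and $\mathrm{J}$
with substitution (`exists_section`, `llp_of_isPullback_diagMap`). -/

namespace TypeTheory

open CategoryTheory

/-! ### Fibrations and lifting in a category with display maps -/

section Display

universe v w

variable {C : Type w} [Category.{v} C]

/-- Composites of isomorphisms and pullbacks of maps in `D`. -/
inductive fibrations (D : MorphismProperty C) : MorphismProperty C
  | of_isIso {X Y : C} (e : X ⟶ Y) [IsIso e] : fibrations D e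
  | of_comp {X Y Z : C} (p : X ⟶ Y) (q : Y ⟶ Z) (hp : D.pullbacks p) (hq : fibrations D q) :
      fibrations D (p ≫ q)

/-- Pullbacks of maps in `D` along arbitrary maps exist and can be chosen in `D`. -/
def HasDisplayPullbacks (D : MorphismProperty C) : Prop :=
  ∀ ⦃E X Y : C⦄ (p : E ⟶ X) (f : Y ⟶ X), D p →
    ∃ (E' : C) (f' : E' ⟶ E) (p' : E' ⟶ Y), IsPullback f' p' p f ∧ D p'

/-- A path object for `p : E ⟶ X` whose reflexivity map lifts against `D`, stably under change of
base and under pullback along fibrations. -/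
structure PathObject (D : MorphismProperty C) {E X : C} (p : E ⟶ X) where
  {prod path : C}
  {fst : prod ⟶ E}
  {snd : prod ⟶ E}
  isPullback : IsPullback fst snd p p
  {ends : path ⟶ prod}
  display : D ends
  {refl : E ⟶ path}
  refl_fst : refl ≫ ends ≫ fst = 𝟙 E
  refl_snd : refl ≫ ends ≫ snd = 𝟙 E
  llp_of_isPullback : ∀ ⦃X' P' : C⦄ (f : X' ⟶ X) (g : P' ⟶ path) (q : P' ⟶ X'),
    IsPullback g q (ends ≫ fst ≫ p) f → ∀ ⦃Y : C⦄ (h : Y ⟶ P'), fibrations D h →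
      ∀ ⦃E' : C⦄ (a : E' ⟶ E) (b : E' ⟶ Y), IsPullback a b refl (h ≫ g) → D.llp b

variable {D : MorphismProperty C}

theorem pullbacks_of_isPullback {E X E' X' : C} {p : E ⟶ X} {p' : E' ⟶ X'} {f' : E' ⟶ E}
    {f : X' ⟶ X} (h : IsPullback f' p' p f) (hp : D p) : D.pullbacks p' :=
  ⟨_, _, _, _, _, hp, h⟩

theorem pullbacks_isPullback {E X E' X' : C} {p : E ⟶ X} {p' : E' ⟶ X'} {f' : E' ⟶ E}
    {f : X' ⟶ X} (h : IsPullback f' p' p f) (hp : D.pullbacks p) : D.pullbacks p' := by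
  obtain ⟨_, _, _, _, _, hd, sq⟩ := hp
  exact pullbacks_of_isPullback (h.paste_horiz sq) hd

theorem le_pullbacks : D ≤ D.pullbacks := fun _ _ _ hp =>
  pullbacks_of_isPullback IsPullback.of_id_fst hp

theorem fibrations_of_pullbacks {E X : C} {p : E ⟶ X} (hp : D.pullbacks p) :
    fibrations D p := by
  simpa using fibrations.of_comp p (𝟙 X) hp (.of_isIso _)

theorem fibrations_of_mem {E X : C} {p : E ⟶ X} (hp : D p) : fibrations D p :=
  fibrations_of_pullbacks (le_pullbacks _ hp)

theorem pullbacks_isIso_comp {E F X : C} (e : E ⟶ F) [IsIso e] {p : F ⟶ X}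
    (hp : D.pullbacks p) : D.pullbacks (e ≫ p) :=
  pullbacks_isPullback (f' := e) (f := 𝟙 X) (IsPullback.of_horiz_isIso ⟨by simp⟩) hp

theorem fibrations_comp {E F X : C} {p : E ⟶ F} {q : F ⟶ X} (hp : fibrations D p)
    (hq : fibrations D q) : fibrations D (p ≫ q) := by
  induction hp with
  | of_isIso e =>
    -- An isomorphism in front of a composite is absorbed into the first factor, which remains a
    -- pullback of the same display map.
    cases hq with
    | of_isIso q => exact .of_isIso _
    | of_comp p q hp hq =>
      rw [← Category.assoc]
      exact .of_comp _ _ (pullbacks_isIso_comp e hp) hq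
  | of_comp p p' hp hp' ih =>
    rw [Category.assoc]
    exact .of_comp _ _ hp (ih hq)

/-- If `p` is a pullback of `d` along `g`, pulling `d` back along `f ≫ g` and cancelling gives the
required square. -/
theorem exists_isPullback_of_pullbacks (hD : HasDisplayPullbacks D) {E X Y : C} {p : E ⟶ X}
    (hp : D.pullbacks p) (f : Y ⟶ X) :
    ∃ (E' : C) (f' : E' ⟶ E) (p' : E' ⟶ Y), IsPullback f' p' p f := by
  obtain ⟨_, _, d, _, g, hd, sq⟩ := hp
  obtain ⟨E', f', p', h, -⟩ := hD d (f ≫ g) hd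
  exact ⟨E', _, p', h.of_right' sq⟩

theorem exists_isPullback_of_fibrations (hD : HasDisplayPullbacks D) {E X Y : C} {p : E ⟶ X}
    (hp : fibrations D p) (f : Y ⟶ X) :
    ∃ (E' : C) (f' : E' ⟶ E) (p' : E' ⟶ Y), IsPullback f' p' p f ∧ fibrations D p' := by
  induction hp generalizing Y with
  | of_isIso e => exact ⟨Y, f ≫ inv e, 𝟙 Y, IsPullback.of_vert_isIso ⟨by simp⟩, .of_isIso _⟩
  | of_comp p q hp hq ih =>
    obtain ⟨F, f', q', h, hq'⟩ := ih f
    obtain ⟨E', f'', p', h'⟩ := exists_isPullback_of_pullbacks hD hp f'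
    exact ⟨E', f'', p' ≫ q', h'.paste_vert h, .of_comp _ _ (pullbacks_isPullback h' hp) hq'⟩

theorem fibrations_isPullback (hD : HasDisplayPullbacks D) {E X E' X' : C} {p : E ⟶ X}
    {p' : E' ⟶ X'} {f' : E' ⟶ E} {f : X' ⟶ X} (h : IsPullback f' p' p f)
    (hp : fibrations D p) : fibrations D p' := by
  obtain ⟨F, g, q, h', hq⟩ := exists_isPullback_of_fibrations hD hp f
  rw [← IsPullback.isoIsPullback_hom_snd _ _ h h']
  exact fibrations_comp (.of_isIso _) hq

/-- A map lifts against `D` as soon as partial sections of `D`-maps over its target extend. -/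
theorem llp_of_sections (hD : HasDisplayPullbacks D) {X Y : C} (j : X ⟶ Y)
    (h : ∀ ⦃E : C⦄ (c : E ⟶ Y) (d : X ⟶ E), D c → d ≫ c = j →
      ∃ e : Y ⟶ E, e ≫ c = 𝟙 Y ∧ j ≫ e = d) : D.llp j := by
  intro E B p hp
  refine ⟨fun {u v} sq => ?_⟩
  obtain ⟨F, v', p', hF, hp'⟩ := hD p v hp
  obtain ⟨e, he, hje⟩ := h p' (hF.lift u j sq.w) hp' (hF.lift_snd _ _ _)
  exact ⟨⟨⟨e ≫ v', by rw [← Category.assoc, hje, hF.lift_fst],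
    by rw [Category.assoc, hF.w, ← Category.assoc, he, Category.id_comp]⟩⟩⟩

theorem exists_lift {A B E X : C} {i : A ⟶ B} {p : E ⟶ X} (hi : D.llp i) (hp : D p)
    (u : A ⟶ E) (v : B ⟶ X) (w : u ≫ p = i ≫ v) : ∃ l : B ⟶ E, i ≫ l = u ∧ l ≫ p = v := by
  have := hi p hp
  have sq : CommSq u i p v := ⟨w⟩
  exact ⟨sq.lift, sq.fac_left, sq.fac_right⟩

/-! ### Path induction, concatenation and transport in a path object -/

namespace PathObject

variable {E X : C} {p : E ⟶ X} (P : PathObject D p)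

def src : P.path ⟶ E := P.ends ≫ P.fst

def tgt : P.path ⟶ E := P.ends ≫ P.snd

theorem ends_fst : P.ends ≫ P.fst = P.src := rfl

theorem ends_snd : P.ends ≫ P.snd = P.tgt := rfl

theorem src_comp : P.src ≫ p = P.tgt ≫ p := by
  rw [← ends_fst, ← ends_snd, Category.assoc, P.isPullback.w, Category.assoc]

theorem refl_src : P.refl ≫ P.src = 𝟙 E := P.refl_fst

theorem refl_tgt : P.refl ≫ P.tgt = 𝟙 E := P.refl_snd

theorem prod_ext {Y : C} {f g : Y ⟶ P.prod} (h₁ : f ≫ P.fst = g ≫ P.fst)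
    (h₂ : f ≫ P.snd = g ≫ P.snd) : f = g := P.isPullback.hom_ext h₁ h₂

theorem fibrations_src (hp : D p) : fibrations D P.src :=
  fibrations_comp (fibrations_of_mem P.display)
    (fibrations_of_pullbacks (pullbacks_of_isPullback P.isPullback.flip hp))

theorem fibrations_tgt (hp : D p) : fibrations D P.tgt :=
  fibrations_comp (fibrations_of_mem P.display)
    (fibrations_of_pullbacks (pullbacks_of_isPullback P.isPullback hp))

theorem llp_of_isPullback_refl {Y E' : C} {h : Y ⟶ P.path} (hh : fibrations D h)
    {a : E' ⟶ E} {b : E' ⟶ Y} (sq : IsPullback a b P.refl h) : D.llp b :=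
  P.llp_of_isPullback (𝟙 X) (𝟙 _) (P.ends ≫ P.fst ≫ p) IsPullback.of_id_fst h hh a b
    (by simpa using sq)

theorem llp_refl : D.llp P.refl :=
  P.llp_of_isPullback_refl (.of_isIso (𝟙 _)) IsPullback.of_id_fst

/-- The map `y ↦ (y, refl (g y))` into the pullback of the source map along a fibration `g`. -/
theorem llp_of_isPullback_src (hD : HasDisplayPullbacks D) {Y F : C} {g : Y ⟶ E}
    (hg : fibrations D g) {a : F ⟶ Y} {b : F ⟶ P.path} (sq : IsPullback a b g P.src)
    {k : Y ⟶ F} (hka : k ≫ a = 𝟙 Y) (hkb : k ≫ b = g ≫ P.refl) : D.llp k := by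
  refine P.llp_of_isPullback_refl (fibrations_isPullback hD sq hg) (a := g) ?_
  -- Since `P.refl ≫ P.src` is the identity, the outer rectangle is trivially a pullback; hence `k`
  -- is the pullback of `P.refl` along the fibration `b`.
  refine IsPullback.flip (IsPullback.of_right (h₁₂ := a) (h₂₂ := P.src) (v₁₃ := g) ?_ hkb sq)
  rw [hka, P.refl_src]
  exact IsPullback.of_id_fst

/-- Concatenation of paths, with the constant path as a strict right unit. -/
theorem exists_concat (hD : HasDisplayPullbacks D) (hp : D p) {F : C} {v u : F ⟶ P.path}
    (sq : IsPullback v u P.tgt P.src) :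
    ∃ m : F ⟶ P.path, m ≫ P.src = v ≫ P.src ∧ m ≫ P.tgt = u ≫ P.tgt ∧
      ∀ ⦃Y : C⦄ (l : Y ⟶ F) (a : Y ⟶ P.path), l ≫ v = a → l ≫ u = a ≫ P.tgt ≫ P.refl →
        l ≫ m = a := by
  -- A path paired with the constant path at its end. Lifting against `k` is induction on the second
  -- path, which makes the right unit law strict and leaves the left one weak.
  let k : P.path ⟶ F := sq.lift (𝟙 _) (P.tgt ≫ P.refl) (by
    rw [Category.assoc, P.refl_src, Category.comp_id, Category.id_comp])
  have hkv : k ≫ v = 𝟙 _ := sq.lift_fst _ _ _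
  have hku : k ≫ u = P.tgt ≫ P.refl := sq.lift_snd _ _ _
  have hkA : D.llp k := P.llp_of_isPullback_src hD (P.fibrations_tgt hp) sq hkv hku
  have hb : (v ≫ P.src) ≫ p = (u ≫ P.tgt) ≫ p := by
    simp only [Category.assoc, ← P.src_comp, ← reassoc_of% sq.w]
  obtain ⟨m, hm, hm'⟩ := exists_lift hkA P.display (𝟙 _)
    (P.isPullback.lift (v ≫ P.src) (u ≫ P.tgt) hb) (by
      apply P.prod_ext
      · rw [Category.id_comp, Category.assoc, P.isPullback.lift_fst, reassoc_of% hkv, ends_fst]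
      · rw [Category.id_comp, Category.assoc, P.isPullback.lift_snd, reassoc_of% hku,
          P.refl_tgt, Category.comp_id, ends_snd])
  refine ⟨m, ?_, ?_, ?_⟩
  · rw [← ends_fst, ← Category.assoc, hm', P.isPullback.lift_fst, ends_fst]
  · rw [← ends_snd, ← Category.assoc, hm', P.isPullback.lift_snd, ends_snd]
  · intro Y l a hl hl'
    have : l = a ≫ k := by
      apply sq.hom_ext
      · rw [hl, Category.assoc, hkv, Category.comp_id]
      · rw [hl', Category.assoc, hku]
    rw [this, Category.assoc, hm, Category.comp_id]

/-- An endomorphism of a path object that fixes endpoints and constant paths is homotopic to the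
identity. -/
theorem exists_homotopy (R : PathObject D P.ends) {w : P.path ⟶ P.path}
    (hw : w ≫ P.ends = P.ends) (hr : P.refl ≫ w = P.refl) :
    ∃ θ : P.path ⟶ R.path, θ ≫ R.src = w ∧ θ ≫ R.tgt = 𝟙 _ ∧
      P.refl ≫ θ = P.refl ≫ R.refl := by
  -- Path induction: at a constant path `w` does nothing, so the constant homotopy is available.
  obtain ⟨θ, h₁, h₂⟩ := exists_lift P.llp_refl R.display (P.refl ≫ R.refl)
    (R.isPullback.lift w (𝟙 _) (by rw [hw, Category.id_comp])) (by
      apply R.prod_ext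
      · rw [Category.assoc, Category.assoc, Category.assoc, R.isPullback.lift_fst, R.ends_fst,
          R.refl_src, hr, Category.comp_id]
      · rw [Category.assoc, Category.assoc, Category.assoc, R.isPullback.lift_snd, R.ends_snd,
          R.refl_tgt])
  refine ⟨θ, ?_, ?_, h₁⟩
  · rw [← ends_fst, ← Category.assoc, h₂, R.isPullback.lift_fst]
  · rw [← ends_snd, ← Category.assoc, h₂, R.isPullback.lift_snd]

/-- Transport in a display map `c` over a pullback `Q` of `p`, along a homotopy between maps
`Q ⟶ Q` that ends at the identity. -/
theorem exists_transport (hD : HasDisplayPullbacks D) (hp : D p) {Q Y F : C} {q₁ : Q ⟶ E}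
    {q : Q ⟶ Y} {σ : Y ⟶ X} (sq : IsPullback q₁ q p σ) {c : F ⟶ Q} (hc : D c) {e : Q ⟶ F}
    {θ : Q ⟶ P.path} (hθ : θ ≫ P.tgt = q₁) (he : e ≫ c ≫ q₁ = θ ≫ P.src) (heq : e ≫ c ≫ q = q) :
    ∃ e' : Q ⟶ F, e' ≫ c = 𝟙 Q ∧
      ∀ ⦃Z : C⦄ (l : Z ⟶ Q), l ≫ θ = l ≫ q₁ ≫ P.refl → l ≫ e' = l ≫ e := by
  have hfib : fibrations D (P.ends ≫ P.fst ≫ p) := by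
    rw [← Category.assoc]
    exact fibrations_comp (P.fibrations_src hp) (fibrations_of_mem hp)
  -- `P'` is the path object of `q`, obtained from that of `p` by change of base along `σ`; `refl'`
  -- is a pullback of `P.refl`.
  obtain ⟨P', g, q', h, -⟩ := exists_isPullback_of_fibrations hD hfib σ
  have hsp : P.src ≫ p = P.ends ≫ P.fst ≫ p := Category.assoc _ _ _
  have hw := h.w
  rw [← hsp] at hw
  let src' : P' ⟶ Q := sq.lift (g ≫ P.src) q' (by rw [Category.assoc, hw])
  let tgt' : P' ⟶ Q := sq.lift (g ≫ P.tgt) q' (by rw [Category.assoc, ← P.src_comp, hw])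
  let refl' : Q ⟶ P' := h.lift (q₁ ≫ P.refl) q (by
    rw [← hsp, Category.assoc, reassoc_of% P.refl_src, sq.w])
  have src'_fst : src' ≫ q₁ = g ≫ P.src := sq.lift_fst _ _ _
  have src'_snd : src' ≫ q = q' := sq.lift_snd _ _ _
  have tgt'_fst : tgt' ≫ q₁ = g ≫ P.tgt := sq.lift_fst _ _ _
  have tgt'_snd : tgt' ≫ q = q' := sq.lift_snd _ _ _
  have refl'_fst : refl' ≫ g = q₁ ≫ P.refl := h.lift_fst _ _ _
  have refl'_snd : refl' ≫ q' = q := h.lift_snd _ _ _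
  have refl'_src : refl' ≫ src' = 𝟙 Q := by
    apply sq.hom_ext
    · rw [Category.assoc, src'_fst, reassoc_of% refl'_fst, P.refl_src, Category.comp_id,
        Category.id_comp]
    · rw [Category.assoc, src'_snd, refl'_snd, Category.id_comp]
  have refl'_tgt : refl' ≫ tgt' = 𝟙 Q := by
    apply sq.hom_ext
    · rw [Category.assoc, tgt'_fst, reassoc_of% refl'_fst, P.refl_tgt, Category.comp_id,
        Category.id_comp]
    · rw [Category.assoc, tgt'_snd, refl'_snd, Category.id_comp]
  -- Points of `F'` are paths in `Q` with a point of `F` over the source; `k` pairs a point of `F`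
  -- with the constant path.
  obtain ⟨F', c', y, h', hy⟩ := hD c src' hc
  let k : F ⟶ F' := h'.lift (𝟙 F) (c ≫ refl') (by
    rw [Category.assoc, refl'_src, Category.id_comp, Category.comp_id])
  have hk₁ : k ≫ c' = 𝟙 F := h'.lift_fst _ _ _
  have hk₂ : k ≫ y = c ≫ refl' := h'.lift_snd _ _ _
  have hkA : D.llp k := by
    refine P.llp_of_isPullback σ g q' h y (fibrations_of_mem hy) (c ≫ q₁) k ?_
    have s₁ : IsPullback q₁ refl' P.refl g := by
      refine (IsPullback.of_bot (h₃₁ := σ) (v₂₁ := q') (v₂₂ := P.ends ≫ P.fst ≫ p)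
        ?_ refl'_fst.symm h)
      rw [refl'_snd, ← hsp, reassoc_of% P.refl_src]
      exact sq
    have s₂ : IsPullback c k refl' y := by
      refine (IsPullback.of_right (h₁₂ := c') (h₂₂ := src') (v₁₃ := c) ?_ hk₂ h').flip
      rw [hk₁, refl'_src]
      exact IsPullback.of_id_fst
    exact s₂.paste_horiz s₁
  -- `T` is transport to the target of the path, strictly the identity along constant paths.
  obtain ⟨T, hT₁, hT₂⟩ := exists_lift hkA hc (𝟙 F) (y ≫ tgt') (by
    rw [reassoc_of% hk₂, refl'_tgt, Category.id_comp, Category.comp_id])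
  let θ' : Q ⟶ P' := h.lift θ q (by
    rw [← hsp, P.src_comp, reassoc_of% hθ, sq.w])
  have hθ'₁ : θ' ≫ g = θ := h.lift_fst _ _ _
  have hθ'₂ : θ' ≫ q' = q := h.lift_snd _ _ _
  let t : Q ⟶ F' := h'.lift e θ' (by
    apply sq.hom_ext
    · rw [Category.assoc, Category.assoc, src'_fst, reassoc_of% hθ'₁, he]
    · rw [Category.assoc, Category.assoc, src'_snd, hθ'₂, heq])
  have ht₁ : t ≫ c' = e := h'.lift_fst _ _ _
  have ht₂ : t ≫ y = θ' := h'.lift_snd _ _ _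
  refine ⟨t ≫ T, ?_, fun Z l hl => ?_⟩
  · rw [Category.assoc, hT₂, reassoc_of% ht₂]
    apply sq.hom_ext
    · rw [Category.assoc, tgt'_fst, reassoc_of% hθ'₁, hθ, Category.id_comp]
    · rw [Category.assoc, tgt'_snd, hθ'₂, Category.id_comp]
  -- Where `θ` is constant, `t` agrees with `e ≫ k`, and `k ≫ T` is the identity.
  · suffices l ≫ t = l ≫ e ≫ k by
      rw [← Category.assoc, this, Category.assoc, Category.assoc, hT₁, Category.comp_id]
    apply h'.hom_ext
    · simp only [Category.assoc, ht₁, hk₁, Category.comp_id]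
    · simp only [Category.assoc, ht₂, hk₂]
      apply h.hom_ext
      · simp only [Category.assoc, hθ'₁, refl'_fst, hl, reassoc_of% he]
        rw [reassoc_of% hl, reassoc_of% P.refl_src]
      · simp only [Category.assoc, hθ'₂, refl'_snd, heq]

/-- A partial section of a display map `c` over the paths out of `s` extends, up to an
endomorphism `w` of the path object. -/
theorem exists_partial_transport (hD : HasDisplayPullbacks D) (hp : D p) {s : X ⟶ E}
    (hs : s ≫ p = 𝟙 X) {Q F : C} {q₁ : Q ⟶ P.path} {q : Q ⟶ E} (hq : D q)
    (hq₁ : q₁ ≫ P.src = q ≫ p ≫ s) (hq₂ : q₁ ≫ P.tgt = q) (hmono : Mono q₁) {j : X ⟶ Q}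
    (hj : j ≫ q₁ = s ≫ P.refl) (hlift : ∀ ⦃Z : C⦄ (a : Z ⟶ P.path) (y : Z ⟶ X),
      a ≫ P.src = y ≫ s → ∃ b : Z ⟶ Q, b ≫ q₁ = a) {c : F ⟶ Q} (hc : D c) {d : X ⟶ F}
    (hd : d ≫ c = j) :
    ∃ (e : Q ⟶ F) (w : P.path ⟶ P.path), w ≫ P.ends = P.ends ∧ P.refl ≫ w = P.refl ∧
      e ≫ c ≫ q₁ = q₁ ≫ w ∧ j ≫ e = d := by
  have hjq : j ≫ q = s := by
    rw [← hq₂, reassoc_of% hj, P.refl_tgt, Category.comp_id]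
  obtain ⟨F₂, v, u, h₂, -⟩ := exists_isPullback_of_fibrations hD (P.fibrations_tgt hp) P.src
  obtain ⟨m, hm₁, hm₂, hm⟩ := P.exists_concat hD hp h₂
  -- `lw` puts a constant path in front, so `lw ≫ m` is left multiplication by a constant path. This
  -- is the endomorphism `w`.
  let lw : P.path ⟶ F₂ := h₂.lift (P.src ≫ P.refl) (𝟙 _) (by
    rw [Category.assoc, P.refl_tgt, Category.comp_id, Category.id_comp])
  have hlw₁ : lw ≫ v = P.src ≫ P.refl := h₂.lift_fst _ _ _
  have hlw₂ : lw ≫ u = 𝟙 _ := h₂.lift_snd _ _ _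
  -- Points of `F₃` are points `z` of `F` with a path in `E` out of the point below `z`.
  obtain ⟨F₃, a, b, h₃, -⟩ := exists_isPullback_of_fibrations hD
    (fibrations_comp (fibrations_of_mem hc) (fibrations_of_mem hq)) P.src
  let k : F ⟶ F₃ := h₃.lift (𝟙 F) ((c ≫ q) ≫ P.refl) (by
    rw [Category.assoc, P.refl_src, Category.comp_id, Category.id_comp])
  have hka : k ≫ a = 𝟙 F := h₃.lift_fst _ _ _
  have hkb : k ≫ b = (c ≫ q) ≫ P.refl := h₃.lift_snd _ _ _
  have hkA : D.llp k := P.llp_of_isPullback_src hD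
    (fibrations_comp (fibrations_of_mem hc) (fibrations_of_mem hq)) h₃ hka hkb
  let l₃ : F₃ ⟶ F₂ := h₂.lift (a ≫ c ≫ q₁) b (by
    rw [← h₃.w, Category.assoc, Category.assoc, hq₂])
  have hl₃₁ : l₃ ≫ v = a ≫ c ≫ q₁ := h₂.lift_fst _ _ _
  have hl₃₂ : l₃ ≫ u = b := h₂.lift_snd _ _ _
  -- The path below `z` followed by the given one still starts on the section `s`, hence is a point
  -- of `Q`.
  obtain ⟨β, hβ⟩ := hlift (l₃ ≫ m) (a ≫ c ≫ q ≫ p) (by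
    simp only [Category.assoc, hm₁, reassoc_of% hl₃₁, hq₁])
  -- The lifting problem commutes on the nose because `m` has a strict right unit: on constant paths
  -- `β` is `c`.
  obtain ⟨T, hT₁, hT₂⟩ := exists_lift hkA hc (𝟙 F) β (by
    rw [← cancel_mono q₁, Category.id_comp, Category.assoc, hβ, ← Category.assoc]
    symm
    apply hm
    · rw [Category.assoc, hl₃₁, reassoc_of% hka]
    · rw [Category.assoc, hl₃₂, hkb, Category.assoc, Category.assoc, reassoc_of% hq₂])
  -- At a point of `Q` over `e`, transport starts from the value of `d` at `p(e)`, which lies over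
  -- the constant path.
  let t : Q ⟶ F₃ := h₃.lift (q ≫ p ≫ d) q₁ (by
    simp only [Category.assoc, reassoc_of% hd, hjq, hq₁])
  have ht₁ : t ≫ a = q ≫ p ≫ d := h₃.lift_fst _ _ _
  have ht₂ : t ≫ b = q₁ := h₃.lift_snd _ _ _
  refine ⟨t ≫ T, lw ≫ m, ?_, ?_, ?_, ?_⟩
  · apply P.prod_ext
    · simp only [Category.assoc, P.ends_fst, hm₁, reassoc_of% hlw₁, P.refl_src, Category.comp_id]
    · simp only [Category.assoc, P.ends_snd, hm₂, reassoc_of% hlw₂]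
  · rw [← Category.assoc]
    apply hm
    · rw [Category.assoc, hlw₁, reassoc_of% P.refl_src]
    · rw [Category.assoc, hlw₂, Category.comp_id, reassoc_of% P.refl_tgt]
  · rw [Category.assoc, reassoc_of% hT₂, hβ, ← Category.assoc, ← Category.assoc]
    congr 1
    apply h₂.hom_ext
    · simp only [Category.assoc, hl₃₁, hlw₁, reassoc_of% ht₁, reassoc_of% hd, hj,
        reassoc_of% hq₁]
    · simp only [Category.assoc, hl₃₂, hlw₂, ht₂, Category.comp_id]
  · suffices j ≫ t = d ≫ k by
      rw [← Category.assoc, this, Category.assoc, hT₁, Category.comp_id]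
    apply h₃.hom_ext
    · simp only [Category.assoc, ht₁, hka, reassoc_of% hjq, reassoc_of% hs, Category.comp_id]
    · simp only [Category.assoc, ht₂, hkb, hj, reassoc_of% hd, reassoc_of% hjq]

end PathObject

/-! ### Factoring sections, and the induction step -/

/-- A section of a display map factors as a map with the left lifting property, followed by a
display map. -/
theorem exists_factorization_of_section (hD : HasDisplayPullbacks D)
    (hP : ∀ ⦃E X : C⦄ (p : E ⟶ X), D p → Nonempty (PathObject D p)) {E X : C} {p : E ⟶ X}
    (hp : D p) {s : X ⟶ E} (hs : s ≫ p = 𝟙 X) :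
    ∃ (Q : C) (j : X ⟶ Q) (q : Q ⟶ E), D.llp j ∧ D q ∧ j ≫ q = s := by
  obtain ⟨P⟩ := hP p hp
  -- `R` consists of homotopies between paths with common endpoints.
  obtain ⟨R⟩ := hP P.ends P.display
  -- Pulling `P.ends` back along $e \mapsto (s(p(e)), e)$ gives the paths from $s(p(e))$ to $e$.
  let σ : E ⟶ P.prod := P.isPullback.lift (p ≫ s) (𝟙 E) (by
    rw [Category.assoc, hs, Category.comp_id, Category.id_comp])
  have hσ₁ : σ ≫ P.fst = p ≫ s := P.isPullback.lift_fst _ _ _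
  have hσ₂ : σ ≫ P.snd = 𝟙 E := P.isPullback.lift_snd _ _ _
  obtain ⟨Q, q₁, q, sq, hq⟩ := hD P.ends σ P.display
  have hq₁ : q₁ ≫ P.src = q ≫ p ≫ s := by
    rw [← P.ends_fst, reassoc_of% sq.w, hσ₁]
  have hq₂ : q₁ ≫ P.tgt = q := by
    rw [← P.ends_snd, reassoc_of% sq.w, hσ₂, Category.comp_id]
  have hmono : Mono q₁ := ⟨fun f g hfg => sq.hom_ext hfg (by
    rw [← hq₂, reassoc_of% hfg])⟩
  have hlift : ∀ ⦃Z : C⦄ (a : Z ⟶ P.path) (y : Z ⟶ X),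
      a ≫ P.src = y ≫ s → ∃ b : Z ⟶ Q, b ≫ q₁ = a := fun Z a y hy =>
    ⟨sq.lift a (a ≫ P.tgt) (by
      apply P.prod_ext
      · rw [Category.assoc, Category.assoc, Category.assoc, hσ₁, ← reassoc_of% P.src_comp,
          reassoc_of% hy, reassoc_of% hs, P.ends_fst, hy]
      · rw [Category.assoc, Category.assoc, Category.assoc, hσ₂, Category.comp_id, P.ends_snd]),
      sq.lift_fst _ _ _⟩
  obtain ⟨j, hj⟩ := hlift (s ≫ P.refl) (𝟙 X) (by
    rw [Category.assoc, P.refl_src, Category.comp_id, Category.id_comp])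
  have hjq : j ≫ q = s := by
    rw [← hq₂, reassoc_of% hj, P.refl_tgt, Category.comp_id]
  refine ⟨Q, j, q, llp_of_sections hD j fun F c d hc hd => ?_, hq, hjq⟩
  obtain ⟨e, w, hw, hr, he, hje⟩ :=
    P.exists_partial_transport hD hp hs hq hq₁ hq₂ hmono hj hlift hc hd
  obtain ⟨θ, hθ₁, hθ₂, hθ⟩ := P.exists_homotopy R hw hr
  -- `e` is a section of `c` only up to `w`; transport along `θ` makes it strict and preserves the
  -- value along `j`, where `θ` is constant.
  obtain ⟨e', he', h⟩ := R.exists_transport hD P.display sq hc (e := e) (θ := q₁ ≫ θ)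
    (by rw [Category.assoc, hθ₂, Category.comp_id]) (by rw [he, Category.assoc, hθ₁])
    (by
      have : e ≫ c ≫ q₁ ≫ P.tgt = q₁ ≫ P.tgt := by
        rw [reassoc_of% he, ← P.ends_snd, reassoc_of% hw]
      rwa [hq₂] at this)
  refine ⟨e', he', ?_⟩
  rw [h j (by rw [reassoc_of% hj, reassoc_of% hj, hθ]), hje]

theorem le_llp_rlp_of_fibrations {E X : C} {p : E ⟶ X} (hp : fibrations D p) :
    D.llp.rlp p := by
  induction hp with
  | of_isIso e => exact MorphismProperty.rlp_of_isIso _ e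
  | of_comp p q hp hq ih =>
    refine MorphismProperty.comp_mem _ p q ?_ ih
    obtain ⟨_, _, _, _, _, hd, sq⟩ := hp
    exact MorphismProperty.of_isPullback sq fun _ _ _ hi => hi _ hd

/-- A map `f` into the domain of a display map `p` factors as a map with the left lifting property,
followed by a fibration, if `f ≫ p` does. -/
theorem exists_factorization_of_display (hD : HasDisplayPullbacks D)
    (hP : ∀ ⦃E X : C⦄ (p : E ⟶ X), D p → Nonempty (PathObject D p)) {E X : C} {p : E ⟶ X}
    (hp : D p) {Y : C} (f : Y ⟶ E) (hf : ∃ (Z : C) (i : Y ⟶ Z) (g : Z ⟶ X),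
      D.llp i ∧ fibrations D g ∧ i ≫ g = f ≫ p) :
    ∃ (Z : C) (i : Y ⟶ Z) (g : Z ⟶ E), D.llp i ∧ fibrations D g ∧ i ≫ g = f := by
  obtain ⟨Z, i, g, hi, hg, w⟩ := hf
  obtain ⟨E', g', p', sq, hp'⟩ := hD p g hp
  -- The pair of `f` and `i` is a partial section of `p'` defined along `i`; lifting extends it to a
  -- section over all of `Z`.
  obtain ⟨s, hs, hs'⟩ := exists_lift hi hp' (sq.lift f i w.symm) (𝟙 Z) (by
    rw [sq.lift_snd, Category.comp_id])
  obtain ⟨Q, j, q, hj, hq, rfl⟩ := exists_factorization_of_section hD hP hp' hs'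
  refine ⟨Q, i ≫ j, q ≫ g', MorphismProperty.comp_mem _ _ _ hi hj,
    fibrations_comp (fibrations_of_mem hq) (fibrations_isPullback hD sq.flip hg), ?_⟩
  have : (i ≫ j ≫ q) ≫ g' = f := by rw [hs, sq.lift_fst]
  simpa using this

end Display

/-! ### Reindexing of dependent contexts -/

variable {S : Signature.{u}}

theorem Tel.subst_subst {n m l k : ℕ} (Δ : Tel S n k) (σ : Sub S n m) (τ : Sub S m l) :
    (Δ.subst σ).subst τ = Δ.subst (σ.comp τ) := by
  induction Δ with
  | nil => rfl
  | snoc Δ A ih => simp only [Tel.subst, ih, Exp.subst_subst, Sub.lift_comp]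

theorem Tel.subst_id {n k : ℕ} (Δ : Tel S n k) : Δ.subst (Sub.id n) = Δ := by
  induction Δ with
  | nil => rfl
  | snoc Δ A ih => simp only [Tel.subst, ih, Exp.subst_id, Sub.lift_id]

theorem Sub.tail_lift {n m k : ℕ} (σ : Sub S n m) :
    Fin.tail (σ.lift (k + 1)) = (σ.lift k).comp (Sub.wk (m + k) 1) := by
  funext i
  simp only [Fin.tail, Sub.lift, Fin.cons_succ, Sub.comp, Exp.ren_eq_subst]
  rfl

namespace Theory

variable {T : Theory S}

/-- `A'` is merely definitionally equal to `A.subst f`, because that is all that is known of a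
reindexed identity type. -/
theorem isMor_lift_one {n m : ℕ} {Φ : Ctx S n} {Ψ : Ctx S m} {f : Sub S m n} {A : Exp S m}
    {A' : Exp S n} (hf : IsMor T.Der Φ Ψ f) (h : T.Der Φ (.typeEq A' (A.subst f))) :
    IsMor T.Der (Φ.snoc A') (Ψ.snoc A) (f.lift 1) := by
  have hA' := (T.isType_of_typeEq h).1
  refine ⟨?_, ?_⟩
  · rw [Sub.tail_lift (k := 0)]
    exact isMor_wk hA' hf
  · rw [Sub.tail_lift (k := 0), ← Exp.subst_subst]
    exact T.conv (T.ax hA') (T.der_over_wk hA' .base h)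

theorem isMor_lift {n m k : ℕ} {Φ : Ctx S n} {Ψ : Ctx S m} {f : Sub S m n} {Δ : Tel S m k}
    (hΦ : T.WF Φ) (hf : IsMor T.Der Φ Ψ f) (hΔ : T.WF (Ψ.append Δ)) :
    T.WF (Φ.append (Δ.subst f)) ∧
      IsMor T.Der (Φ.append (Δ.subst f)) (Ψ.append Δ) (f.lift k) := by
  induction Δ with
  | nil => exact ⟨hΦ, hf⟩
  | snoc Δ A ih =>
    obtain ⟨h₁, h₂⟩ := ih hΔ.1
    have hA := T.der_subst h₁ h₂ hΔ.2
    exact ⟨⟨h₁, hA⟩, isMor_lift_one h₂ (T.type_refl hA)⟩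

theorem morEq_wk {n l : ℕ} {Γ : Ctx S n} {A : Exp S n} {Ξ : Ctx S l} {σ τ : Sub S l n}
    (hΓ : T.WF (Γ.snoc A)) (h : MorEq T.Der Γ Ξ σ τ) :
    MorEq T.Der (Γ.snoc A) Ξ (σ.comp (Sub.wk n 1)) (τ.comp (Sub.wk n 1)) :=
  morEq_comp_left hΓ (isMor_wk hΓ.2 (isMor_id hΓ.1)) h

/-- Equal morphisms reindex `Δ` to contexts that agree only up to definitional equality, so `g.lift
k` has to be typed over the reindexing along `f`. Each further type is compared by `subst_typeEq`.
-/
theorem ctxEq_morEq_lift {n m k : ℕ} {Φ : Ctx S n} {Ψ : Ctx S m} {f g : Sub S m n}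
    {Δ : Tel S m k} (hΦ : T.WF Φ) (hf : IsMor T.Der Φ Ψ f) (hg : IsMor T.Der Φ Ψ g)
    (h : MorEq T.Der Φ Ψ f g) (hΔ : T.WF (Ψ.append Δ)) :
    CtxEq T.Der (Φ.append (Δ.subst f)) (Φ.append (Δ.subst g)) ∧
      IsMor T.Der (Φ.append (Δ.subst f)) (Ψ.append Δ) (g.lift k) ∧
      MorEq T.Der (Φ.append (Δ.subst f)) (Ψ.append Δ) (f.lift k) (g.lift k) := by
  induction Δ with
  | nil => exact ⟨ctxEq_refl hΦ, hg, h⟩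
  | snoc Δ A ih =>
    obtain ⟨h₁, h₂, h₃⟩ := ih hΔ.1
    obtain ⟨hW, hf'⟩ := isMor_lift hΦ hf hΔ
    have e := T.subst_typeEq hW.1 (isMor_lift hΦ hf hΔ.1).2 h₂ h₃ hΔ.2
    refine ⟨⟨h₁, e⟩, isMor_lift_one h₂ e, ?_, ?_⟩
    · rw [Sub.tail_lift, Sub.tail_lift]
      exact morEq_wk hW h₃
    · exact T.refl hf'.2

end Theory

/-! ### Identity contexts and the elimination rule under substitution -/

/-- The context `(Γ, x ∈ A, y ∈ A, u ∈ Id(x, y))`. -/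
def IdentityTypes.ctx {T : Theory S} (I : IdentityTypes T) {n : ℕ} (Γ : Ctx S n) (A : Exp S n) :
    Ctx S (n + 3) :=
  ((Γ.snoc A).snoc A.wk).snoc (I.Id A.wk.wk (.var 1) (.var 0))

/-- The substitution `(x, x, r(x))` for `x, y, u`. -/
def IdentityTypes.diag {T : Theory S} (I : IdentityTypes T) {n : ℕ} (A : Exp S n) :
    Sub S (n + 3) (n + 1) :=
  Fin.cons (I.r A.wk (.var 0)) (Fin.cons (.var 0) (Sub.id (n + 1)))

namespace IdentityTypes

open Theory

variable {T : Theory S} (I : IdentityTypes T)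

theorem wk_subst_lift_one {n m : ℕ} (A : Exp S n) (σ : Sub S n m) :
    A.wk.subst (σ.lift 1) = (A.subst σ).wk := by
  rw [Exp.wk_subst, Sub.tail_lift (k := 0), ← Exp.subst_subst]
  rfl

theorem wf_pair {n : ℕ} {Γ : Ctx S n} {A : Exp S n} (hA : T.Der Γ (.isType A)) :
    T.WF ((Γ.snoc A).snoc A.wk) :=
  ⟨⟨T.wf_of_der hA, hA⟩, T.der_over_wk hA .base hA⟩

theorem mem_pair_zero {n : ℕ} {Γ : Ctx S n} {A : Exp S n} (hA : T.Der Γ (.isType A)) :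
    T.Der ((Γ.snoc A).snoc A.wk) (.mem (.var 0) A.wk.wk) :=
  T.ax (wf_pair hA).2

theorem mem_pair_one {n : ℕ} {Γ : Ctx S n} {A : Exp S n} (hA : T.Der Γ (.isType A)) :
    T.Der ((Γ.snoc A).snoc A.wk) (.mem (.var 1) A.wk.wk) :=
  T.der_over_wk (wf_pair hA).2 .base (T.ax hA)

theorem isType_Id {n : ℕ} {Γ : Ctx S n} {A a b : Exp S n} (ha : T.Der Γ (.mem a A))
    (hb : T.Der Γ (.mem b A)) : T.Der Γ (.isType (I.Id A a b)) :=
  I.formation (T.isType_of_mem ha) ha hb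

theorem wf_ctx {n : ℕ} {Γ : Ctx S n} {A : Exp S n} (hA : T.Der Γ (.isType A)) :
    T.WF (I.ctx Γ A) :=
  ⟨wf_pair hA, I.isType_Id (mem_pair_one hA) (mem_pair_zero hA)⟩

/-- Context morphisms into `(Γ, x ∈ A, y ∈ A, u ∈ Id(x, y))`. -/
theorem isMor_ctx {n m : ℕ} {Γ : Ctx S n} {A : Exp S n} (hA : T.Der Γ (.isType A)) {Ξ : Ctx S m}
    {σ : Sub S n m} {a b p : Exp S m} (hΞ : T.WF Ξ) (hσ : IsMor T.Der Ξ Γ σ)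
    (ha : T.Der Ξ (.mem a (A.subst σ))) (hb : T.Der Ξ (.mem b (A.subst σ)))
    (hp : T.Der Ξ (.mem p (I.Id (A.subst σ) a b))) :
    IsMor T.Der Ξ (I.ctx Γ A) (Fin.cons p (Fin.cons b (Fin.cons a σ))) := by
  have h₂ : IsMor T.Der Ξ ((Γ.snoc A).snoc A.wk) (Fin.cons b (Fin.cons a σ)) := by
    refine ⟨⟨hσ, ha⟩, ?_⟩
    rw [Exp.wk_subst]
    exact hb
  refine ⟨h₂, T.conv hp (T.type_symm ?_)⟩
  have := I.Id_subst hΞ h₂ (mem_pair_one hA) (mem_pair_zero hA)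
  rw [Exp.wk_subst, Exp.wk_subst] at this
  exact this

theorem isMor_diag {n : ℕ} {Γ : Ctx S n} {A : Exp S n} (hA : T.Der Γ (.isType A)) :
    IsMor T.Der (Γ.snoc A) (I.ctx Γ A) (I.diag A) := by
  have hW : T.WF (Γ.snoc A) := ⟨T.wf_of_der hA, hA⟩
  have h := I.isMor_ctx hA hW (isMor_wk hA (isMor_id hW.1)) (T.ax hA) (T.ax hA)
    (I.introduction (T.ax hA))
  convert h using 1
  refine funext fun i => ?_
  refine Fin.cases rfl (fun i => Fin.cases rfl (fun i => Fin.cases rfl (fun i => rfl) i) i) i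

section

variable {n m : ℕ} {Γ : Ctx S n} {A : Exp S n} {Ξ : Ctx S m} {τ : Sub S n m}

theorem typeEq_wk_lift (hA : T.Der Γ (.isType A)) (hΞ : T.WF Ξ) (hτ : IsMor T.Der Ξ Γ τ) :
    T.Der (Ξ.snoc (A.subst τ)) (.typeEq (A.subst τ).wk (A.wk.subst (τ.lift 1))) := by
  rw [wk_subst_lift_one]
  exact T.type_refl (wf_pair (T.der_subst hΞ hτ hA)).2

theorem isMor_snoc_lift (hA : T.Der Γ (.isType A)) (hΞ : T.WF Ξ) (hτ : IsMor T.Der Ξ Γ τ) :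
    IsMor T.Der (Ξ.snoc (A.subst τ)) (Γ.snoc A) (τ.lift 1) :=
  isMor_lift_one hτ (T.type_refl (T.der_subst hΞ hτ hA))

theorem isMor_pair_lift (hA : T.Der Γ (.isType A)) (hΞ : T.WF Ξ) (hτ : IsMor T.Der Ξ Γ τ) :
    IsMor T.Der ((Ξ.snoc (A.subst τ)).snoc (A.subst τ).wk) ((Γ.snoc A).snoc A.wk) (τ.lift 2) :=
  isMor_lift_one (isMor_snoc_lift hA hΞ hτ) (typeEq_wk_lift hA hΞ hτ)

theorem typeEq_Id_lift (hA : T.Der Γ (.isType A)) (hΞ : T.WF Ξ) (hτ : IsMor T.Der Ξ Γ τ) :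
    T.Der ((Ξ.snoc (A.subst τ)).snoc (A.subst τ).wk)
      (.typeEq (I.Id (A.subst τ).wk.wk (.var 1) (.var 0))
        ((I.Id A.wk.wk (.var 1) (.var 0)).subst (τ.lift 2))) := by
  have e : A.wk.wk.subst (τ.lift 2) = (A.subst τ).wk.wk := by
    rw [← wk_subst_lift_one]; exact wk_subst_lift_one A.wk (τ.lift 1)
  have := I.Id_subst (wf_pair (T.der_subst hΞ hτ hA)) (isMor_pair_lift hA hΞ hτ)
    (mem_pair_one hA) (mem_pair_zero hA)
  rw [e] at this
  exact T.type_symm this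

theorem isMor_ctx_lift (hA : T.Der Γ (.isType A)) (hΞ : T.WF Ξ) (hτ : IsMor T.Der Ξ Γ τ) :
    IsMor T.Der (I.ctx Ξ (A.subst τ)) (I.ctx Γ A) (τ.lift 3) :=
  isMor_lift_one (isMor_pair_lift hA hΞ hτ) (I.typeEq_Id_lift hA hΞ hτ)

end

theorem tail_diag_comp {n m : ℕ} (A : Exp S n) (τ : Sub S n m) :
    Fin.tail ((I.diag A).comp (τ.lift 1)) = Fin.tail ((τ.lift 3).comp (I.diag (A.subst τ))) := by
  refine funext fun i => ?_
  refine Fin.cases rfl (fun i => Fin.cases rfl (fun i => ?_) i) i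
  simp only [Fin.tail, Sub.comp, diag, Sub.lift, Fin.cons_succ, Sub.id, Exp.subst,
    Exp.ren_eq_subst, Exp.subst_subst]
  rfl

/-- The composites coincide as expressions except in the last entry (`tail_diag_comp`); there the
equality is `r_subst`, converted to the right type by `Id_subst`. -/
theorem morEq_diag_comp {n m : ℕ} {Γ : Ctx S n} {A : Exp S n} (hA : T.Der Γ (.isType A))
    {Ξ : Ctx S m} {τ : Sub S n m} (hΞ : T.WF Ξ) (hτ : IsMor T.Der Ξ Γ τ) :
    MorEq T.Der (Ξ.snoc (A.subst τ)) (I.ctx Γ A) ((I.diag A).comp (τ.lift 1))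
      ((τ.lift 3).comp (I.diag (A.subst τ))) := by
  have hA' := T.der_subst hΞ hτ hA
  have hW : T.WF (Ξ.snoc (A.subst τ)) := ⟨hΞ, hA'⟩
  have h₁ : IsMor T.Der (Ξ.snoc (A.subst τ)) (Γ.snoc A) (τ.lift 1) :=
    isMor_lift_one hτ (T.type_refl hA')
  have hm := isMor_comp hW h₁ (I.isMor_diag hA)
  refine ⟨?_, ?_⟩
  · rw [← tail_diag_comp]
    exact morEq_refl hm.1
  · have := I.r_subst hW h₁ (T.ax hA)
    rw [wk_subst_lift_one] at this
    refine T.conv_eq this (T.type_symm ?_)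
    have h := I.Id_subst hW hm.1 (mem_pair_one hA) (mem_pair_zero hA)
    rw [Exp.wk_subst, Exp.wk_subst] at h
    rw [← wk_subst_lift_one, Exp.wk_subst]
    exact h

section

variable {n m k : ℕ} {Γ : Ctx S n} {A : Exp S n} {Θ : Tel S (n + 3) k} {C : Exp S (n + 3 + k)}
  {d : Exp S (n + 1 + k)}

theorem motive_subst (hA : T.Der Γ (.isType A)) {Ξ : Ctx S m} {τ : Sub S n m} (hΞ : T.WF Ξ)
    (hτ : IsMor T.Der Ξ Γ τ) (hC : T.Der ((I.ctx Γ A).append Θ) (.isType C)) :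
    T.Der ((I.ctx Ξ (A.subst τ)).append (Θ.subst (τ.lift 3)))
      (.isType (C.subst ((τ.lift 3).lift k))) := by
  obtain ⟨h₁, h₂⟩ := isMor_lift (I.wf_ctx (T.der_subst hΞ hτ hA)) (I.isMor_ctx_lift hA hΞ hτ)
    (T.wf_of_der hC)
  exact T.der_subst h₁ h₂ hC

/-- Substituting in `hd` reindexes along the diagonal and then `τ`, whereas elimination over `Ξ`
expects the other order. The two differ by `morEq_diag_comp`, so both context and type are
converted. -/
theorem method_subst (hA : T.Der Γ (.isType A)) {Ξ : Ctx S m} {τ : Sub S n m} (hΞ : T.WF Ξ)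
    (hτ : IsMor T.Der Ξ Γ τ) (hC : T.Der ((I.ctx Γ A).append Θ) (.isType C))
    (hd : T.Der ((Γ.snoc A).append (Θ.subst (I.diag A))) (.mem d (C.subst ((I.diag A).lift k)))) :
    T.Der ((Ξ.snoc (A.subst τ)).append ((Θ.subst (τ.lift 3)).subst (I.diag (A.subst τ))))
      (.mem (d.subst ((τ.lift 1).lift k))
        ((C.subst ((τ.lift 3).lift k)).subst ((I.diag (A.subst τ)).lift k))) := by
  have hA' := T.der_subst hΞ hτ hA
  have hW : T.WF (Ξ.snoc (A.subst τ)) := ⟨hΞ, hA'⟩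
  have h₁ : IsMor T.Der (Ξ.snoc (A.subst τ)) (Γ.snoc A) (τ.lift 1) :=
    isMor_lift_one hτ (T.type_refl hA')
  have hf := isMor_comp hW h₁ (I.isMor_diag hA)
  have hg := isMor_comp hW (I.isMor_diag hA') (I.isMor_ctx_lift hA hΞ hτ)
  have he := I.morEq_diag_comp hA hΞ hτ
  have hΔ := T.wf_of_der hC
  obtain ⟨hW₁, hf₁⟩ := isMor_lift hW hf hΔ
  obtain ⟨hW₂, -⟩ := isMor_lift hW hg hΔ
  obtain ⟨c, hg₁, hfg⟩ := ctxEq_morEq_lift hW hf hg he hΔ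
  have h₃ := isMor_lift hW h₁ (T.wf_of_der hd)
  have hd' := T.der_subst h₃.1 h₃.2 hd
  rw [Judgement.subst, Tel.subst_subst, Exp.subst_subst, ← Sub.lift_comp] at hd'
  rw [Tel.subst_subst, Exp.subst_subst, ← Sub.lift_comp, ← der_of_ctxEq hW₁ hW₂ c]
  exact T.conv hd' (T.subst_typeEq hW₁ hf₁ hg₁ hfg hC)

/-- Elimination with variables for the endpoints and the path. -/
theorem exists_section (hA : T.Der Γ (.isType A))
    (hC : T.Der ((I.ctx Γ A).append Θ) (.isType C))
    (hd : T.Der ((Γ.snoc A).append (Θ.subst (I.diag A))) (.mem d (C.subst ((I.diag A).lift k)))) :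
    ∃ c : Exp S (n + 3 + k), T.Der ((I.ctx Γ A).append Θ) (.mem c C) ∧
      T.Der ((Γ.snoc A).append (Θ.subst (I.diag A)))
        (.memEq (c.subst ((I.diag A).lift k)) d (C.subst ((I.diag A).lift k))) := by
  have hΓ := T.wf_of_der hA
  have hW : T.WF (Γ.snoc A) := ⟨hΓ, hA⟩
  have hP := I.wf_ctx hA
  have hτ₁ : IsMor T.Der (Γ.snoc A) Γ (Sub.wk n 1) := isMor_wk hA (isMor_id hΓ)
  have hid := isMor_id hP
  have hτ : IsMor T.Der (I.ctx Γ A) Γ (Sub.wk n 3) := hid.1.1.1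
  have ha : T.Der (I.ctx Γ A) (.mem (.var 2) (A.subst (Sub.wk n 3))) := hid.1.1.2
  have hb : T.Der (I.ctx Γ A) (.mem (.var 1) (A.subst (Sub.wk n 3))) := by
    have := hid.1.2
    rw [Exp.wk_subst] at this
    exact this
  have hp : T.Der (I.ctx Γ A) (.mem (.var 0) (I.Id (A.subst (Sub.wk n 3)) (.var 2) (.var 1))) := by
    refine T.conv hid.2 ?_
    have := I.Id_subst hP hid.1 (mem_pair_one hA) (mem_pair_zero hA)
    rw [Exp.wk_subst, Exp.wk_subst] at this
    exact this
  -- All data are weakened to `I.ctx Γ A`, so that `J` can be applied to its own variables $x, y,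
  -- u$, which are `.var 2`, `.var 1`, `.var 0`.
  have hC₃ := I.motive_subst hA hP hτ hC
  have hd₃ := I.method_subst hA hP hτ hC hd
  have hC₁ := I.motive_subst hA hW hτ₁ hC
  have hd₁ := I.method_subst hA hW hτ₁ hC hd
  have e₃ : ((Sub.wk n 3).lift 3).comp (Sub.inst₃ (.var 2) (.var 1) (.var 0)) =
      (Sub.id (n + 3) : Sub S _ _) := by
    refine funext fun i => ?_
    refine Fin.cases rfl (fun i => Fin.cases rfl (fun i => Fin.cases rfl (fun i => rfl) i) i) i
  have e₁ : ((Sub.wk n 1).lift 3).comp (Sub.inst₃ (.var 0) (.var 0) (I.r A.wk (.var 0))) =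
      I.diag A := by
    refine funext fun i => ?_
    refine Fin.cases rfl (fun i => Fin.cases rfl (fun i => Fin.cases rfl (fun i => rfl) i) i) i
  have e₀ : ((Sub.wk n 1).lift 1).comp (Sub.inst (.var 0)) = (Sub.id (n + 1) : Sub S _ _) := by
    refine funext fun i => ?_
    refine Fin.cases rfl (fun i => rfl) i
  -- Restricted to the diagonal, the data weakened by three variables become the data weakened by
  -- $x$ alone; `J_subst` therefore leads to the term governed by `computation` over `Γ.snoc A`.
  have e₂ : (Sub.wk n 3).comp (I.diag A) = Sub.wk n 1 := rfl
  have hc := I.elimination ha hb hp hC₃ hd₃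
  have hs := I.J_subst hW (I.isMor_diag hA) ha hb hp hC₃ hd₃
  have hcomp := I.computation (T.ax hA) hC₁ hd₁
  generalize I.J (A.subst (Sub.wk n 3)) (Θ.subst ((Sub.wk n 3).lift 3)) _ _ _ _ _ = c at hc hs
  refine ⟨c, ?_, ?_⟩
  · rwa [Tel.subst_subst, Exp.subst_subst, ← Sub.lift_comp, e₃, Tel.subst_id, Sub.lift_id,
      Exp.subst_id] at hc
  · change T.Der ((Γ.snoc A).append (Tel.subst (Sub.inst₃ (.var 0) (.var 0) (I.r A.wk (.var 0)))
      (Tel.subst ((Sub.wk n 1).lift 3) Θ))) _ at hcomp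
    rw [Tel.subst_subst, Exp.subst_subst d, Exp.subst_subst C, ← Sub.lift_comp, ← Sub.lift_comp,
      e₁, e₀, Sub.lift_id, Exp.subst_id] at hcomp
    rw [Tel.subst_subst _ _ (Sub.inst₃ _ _ _), Exp.subst_subst C _ ((Sub.inst₃ _ _ _).lift k),
      ← Sub.lift_comp _ (Sub.inst₃ _ _ _), e₃, Tel.subst_id, Sub.lift_id, Exp.subst_id,
      Tel.subst_subst, Exp.subst_subst A, Exp.subst_subst C, Exp.subst_subst d] at hs
    simp only [← Sub.lift_comp, e₂] at hs
    exact T.trans hs hcomp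

end

end IdentityTypes

/-! ### Display maps and fibrations in the classifying category -/

open CategoryTheory Limits

/-- Maps of the classifying category are equivalence classes and lifts are built from
representatives, so existence and uniqueness are separated. -/
theorem isPullback_of_exists_lift {C : Type*} [Category* C] {P X Y Z : C} {fst : P ⟶ X}
    {snd : P ⟶ Y} {f : X ⟶ Z} {g : Y ⟶ Z} (w : fst ≫ f = snd ≫ g)
    (lift : ∀ ⦃W : C⦄ (a : W ⟶ X) (b : W ⟶ Y), a ≫ f = b ≫ g →
      ∃ l : W ⟶ P, l ≫ fst = a ∧ l ≫ snd = b)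
    (ext : ∀ ⦃W : C⦄ (l l' : W ⟶ P), l ≫ fst = l' ≫ fst → l ≫ snd = l' ≫ snd → l = l') :
    IsPullback fst snd f g :=
  ⟨⟨w⟩, ⟨PullbackCone.IsLimit.mk w (fun s => (lift s.fst s.snd s.condition).choose)
    (fun s => (lift s.fst s.snd s.condition).choose_spec.1)
    (fun s => (lift s.fst s.snd s.condition).choose_spec.2)
    (fun s _ h₁ h₂ => ext _ _
      (h₁.trans (lift s.fst s.snd s.condition).choose_spec.1.symm)
      (h₂.trans (lift s.fst s.snd s.condition).choose_spec.2.symm))⟩⟩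

namespace Theory

variable {T : Theory S}

namespace Cl

theorem homMk_eq_iff {n m : ℕ} {Φ : Ctx S n} {Ψ : Ctx S m} {hΦ : T.WF Φ} {hΨ : T.WF Ψ}
    {f g : Sub S m n} {hf : IsMor T.Der Φ Ψ f} {hg : IsMor T.Der Φ Ψ g} :
    homMk hΦ hΨ f hf = homMk hΦ hΨ g hg ↔ MorEq T.Der Φ Ψ f g := by
  constructor
  · intro h
    exact Quotient.exact h ⟨Φ, hΦ⟩ ⟨Ψ, hΨ⟩ rfl rfl
  · intro h
    refine Quotient.sound fun Φ' Ψ' hΦ' hΨ' => ?_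
    exact morEq_of_ctxEq hΦ Φ'.2 hΨ Ψ'.2
      (Quotient.exact (s := T.ctxSetoid n) hΦ'.symm)
      (Quotient.exact (s := T.ctxSetoid m) hΨ'.symm) hf hg h

theorem homMk_comp {n m l : ℕ} {Φ : Ctx S n} {Ψ : Ctx S m} {Ξ : Ctx S l} {hΦ : T.WF Φ}
    {hΨ : T.WF Ψ} {hΞ : T.WF Ξ} {f : Sub S m n} {g : Sub S l m} {hf : IsMor T.Der Φ Ψ f}
    {hg : IsMor T.Der Ψ Ξ g} :
    homMk hΦ hΨ f hf ≫ homMk hΨ hΞ g hg = homMk hΦ hΞ (g.comp f) (isMor_comp hΦ hf hg) := rfl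

theorem homMk_id {n : ℕ} {Φ : Ctx S n} (hΦ : T.WF Φ) :
    homMk hΦ hΦ (Sub.id n) (isMor_id hΦ) = 𝟙 (mk' Φ hΦ) := rfl

theorem exists_homMk {n m : ℕ} {Φ : Ctx S n} {Ψ : Ctx S m} {hΦ : T.WF Φ} {hΨ : T.WF Ψ}
    (φ : mk' Φ hΦ ⟶ mk' Ψ hΨ) :
    ∃ (f : Sub S m n) (hf : IsMor T.Der Φ Ψ f), φ = homMk hΦ hΨ f hf := by
  induction φ using Quotient.inductionOn with
  | h f => exact ⟨f.1, f.2 ⟨Φ, hΦ⟩ ⟨Ψ, hΨ⟩ rfl rfl, rfl⟩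

theorem exists_eq_mk' (X : T.Cl) : ∃ (n : ℕ) (Γ : Ctx S n) (hΓ : T.WF Γ), X = mk' Γ hΓ := by
  obtain ⟨n, X⟩ := X
  induction X using Quotient.inductionOn with
  | h Γ => exact ⟨n, Γ.1, Γ.2, rfl⟩

/-- The display map `(Γ, x ∈ A) → Γ`. -/
def display {n : ℕ} {Γ : Ctx S n} {A : Exp S n} (h : T.WF (Γ.snoc A)) :
    mk' (Γ.snoc A) h ⟶ mk' Γ h.1 :=
  homMk h h.1 (Sub.wk n 1) (isMor_wk h.2 (isMor_id h.1))

theorem displayMaps_display {n : ℕ} {Γ : Ctx S n} {A : Exp S n} (h : T.WF (Γ.snoc A)) :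
    T.displayMaps (display h) := .mk Γ A h

theorem homMk_display {n m : ℕ} {Φ : Ctx S m} {hΦ : T.WF Φ} {Γ : Ctx S n} {A : Exp S n}
    (h : T.WF (Γ.snoc A)) {f : Sub S (n + 1) m} (hf : IsMor T.Der Φ (Γ.snoc A) f) :
    homMk hΦ h f hf ≫ display h = homMk hΦ h.1 (Fin.tail f) hf.1 := rfl

theorem display_homMk {n m : ℕ} {Ξ : Ctx S m} {hΞ : T.WF Ξ} {Γ : Ctx S n} {A : Exp S n}
    (h : T.WF (Γ.snoc A)) {f : Sub S m n} (hf : IsMor T.Der Γ Ξ f) :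
    display h ≫ homMk h.1 hΞ f hf = homMk h hΞ (f.comp (Sub.wk n 1)) (isMor_wk h.2 hf) := rfl

/-- A compatible pair $(f, g)$ lifts to $g$ extended by the last entry of $f$, once that entry is
converted along $A(\mathrm{tail}\, f) = A(\sigma g) = A'(g)$. Allowing `A'` to differ from `A.subst
σ` makes the lemma apply to identity types. -/
theorem isPullback_display {n m : ℕ} {Γ : Ctx S n} {A : Exp S n} (h : T.WF (Γ.snoc A))
    {Γ' : Ctx S m} {A' : Exp S m} (h' : T.WF (Γ'.snoc A')) {σ : Sub S n m}
    (hσ : IsMor T.Der Γ' Γ σ) (e : T.Der Γ' (.typeEq A' (A.subst σ))) :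
    IsPullback (homMk h' h (σ.lift 1) (isMor_lift_one hσ e)) (display h') (display h)
      (homMk h'.1 h.1 σ hσ) := by
  have ht : ∀ {l : ℕ} (f : Sub S (m + 1) l),
      Fin.tail ((σ.lift 1).comp f) = σ.comp (Fin.tail f) := by
    intro l f
    funext i
    simp only [Fin.tail, Sub.comp, Sub.lift, Fin.cons_succ, Exp.ren_subst]
    rfl
  refine isPullback_of_exists_lift ?_ ?_ ?_
  · refine (homMk_display h _).trans ((homMk_eq_iff.2 ?_).trans (display_homMk h' hσ).symm)
    rw [Sub.tail_lift (k := 0)]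
    exact morEq_refl (isMor_wk h'.2 hσ)
  · intro W a b w
    obtain ⟨l, Φ, hΦ, rfl⟩ := W.exists_eq_mk'
    obtain ⟨f, hf, rfl⟩ := exists_homMk a
    obtain ⟨g, hg, rfl⟩ := exists_homMk b
    have hσg := isMor_comp hΦ hg hσ
    have w' : MorEq T.Der Φ Γ (Fin.tail f) (σ.comp g) :=
      (homMk_eq_iff (hf := hf.1) (hg := hσg)).1 w
    have e₁ := T.subst_typeEq hΦ hf.1 hσg w' h.2
    have e₂ := T.der_subst hΦ hg e
    rw [Judgement.subst, Exp.subst_subst] at e₂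
    have hl : IsMor T.Der Φ (Γ'.snoc A') (Fin.cons (f 0) g : Sub S (m + 1) l) :=
      ⟨hg, T.conv hf.2 (T.type_trans e₁ (T.type_symm e₂))⟩
    have hm := isMor_lift_one hσ e
    refine ⟨homMk hΦ h' _ hl,
      (homMk_eq_iff (hf := isMor_comp hΦ hl hm) (hg := hf)).2 ⟨?_, ?_⟩, rfl⟩
    · rw [ht]
      exact morEq_symm hΦ h.1 hf.1 hσg w'
    · rw [ht]
      exact T.refl (T.conv hf.2 e₁)
  · intro W a b w₁ w₂
    obtain ⟨l, Φ, hΦ, rfl⟩ := W.exists_eq_mk'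
    obtain ⟨f, hf, rfl⟩ := exists_homMk a
    obtain ⟨g, hg, rfl⟩ := exists_homMk b
    have hm := isMor_lift_one hσ e
    have h₁ := ((homMk_eq_iff (hf := isMor_comp hΦ hf hm) (hg := isMor_comp hΦ hg hm)).1 w₁).2
    have e₂ := T.der_subst hΦ hf.1 e
    rw [Judgement.subst, Exp.subst_subst] at e₂
    rw [ht] at h₁
    exact homMk_eq_iff.2 ⟨(homMk_eq_iff (hf := hf.1) (hg := hg.1)).1 w₂,
      T.conv_eq h₁ (T.type_symm e₂)⟩

theorem isPullback_proj {n m k : ℕ} {Γ : Ctx S n} {Δ : Tel S n k} (h : T.WF (Γ.append Δ))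
    {Γ' : Ctx S m} (hΓ' : T.WF Γ') {σ : Sub S n m} (hσ : IsMor T.Der Γ' Γ σ) :
    IsPullback (homMk (isMor_lift hΓ' hσ h).1 h (σ.lift k) (isMor_lift hΓ' hσ h).2)
      (proj Γ' (Δ.subst σ) (isMor_lift hΓ' hσ h).1) (proj Γ Δ h)
      (homMk hΓ' (wf_of_append h) σ hσ) := by
  induction Δ with
  | nil => exact IsPullback.of_id_snd
  | snoc Δ A ih =>
    exact (isPullback_display h (isMor_lift hΓ' hσ h).1 (isMor_lift hΓ' hσ h.1).2
      (T.type_refl (isMor_lift hΓ' hσ h).1.2)).paste_vert (ih h.1)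

end Cl

open Cl

variable (T) in
theorem hasDisplayPullbacks : HasDisplayPullbacks T.displayMaps := by
  intro E X Y p f hp
  obtain ⟨m, Γ', hΓ', rfl⟩ := Y.exists_eq_mk'
  obtain ⟨Γ, A, h⟩ := hp
  obtain ⟨σ, hσ, rfl⟩ := exists_homMk f
  have hA : T.Der Γ' (.isType (A.subst σ)) := T.der_subst hΓ' hσ h.2
  have h' : T.WF (Γ'.snoc (A.subst σ)) := ⟨hΓ', hA⟩
  exact ⟨_, _, _, isPullback_display h h' hσ (T.type_refl hA), displayMaps_display _⟩

theorem exists_iso_display {n : ℕ} {Γ : Ctx S n} {hΓ : T.WF Γ} {E : T.Cl} {p : E ⟶ mk' Γ hΓ}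
    (hp : T.displayMaps.pullbacks p) :
    ∃ (A : Exp S n) (h : T.WF (Γ.snoc A)) (e : E ≅ mk' (Γ.snoc A) h), p = e.hom ≫ display h := by
  obtain ⟨_, _, d, _, g, hd, sq⟩ := hp
  obtain ⟨Γ₀, A, h⟩ := hd
  obtain ⟨σ, hσ, rfl⟩ := exists_homMk g
  have hA : T.Der Γ (.isType (A.subst σ)) := T.der_subst hΓ hσ h.2
  have h' : T.WF (Γ.snoc (A.subst σ)) := ⟨hΓ, hA⟩
  have sq' := isPullback_display h h' hσ (T.type_refl hA)
  exact ⟨_, _, sq.isoIsPullback _ _ sq', (sq.isoIsPullback_hom_snd _ _ sq').symm⟩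

/-- Intermediate objects of a composite are contexts only up to isomorphism; carrying `e` along lets
each factor be replaced by the adjunction of one type to `Δ`. -/
theorem exists_iso_proj {Y Z : T.Cl} {p : Y ⟶ Z} (hp : fibrations T.displayMaps p) {n : ℕ}
    {Γ : Ctx S n} {hΓ : T.WF Γ} (e : Z ≅ mk' Γ hΓ) :
    ∃ (k : ℕ) (Δ : Tel S n k) (h : T.WF (Γ.append Δ)) (e' : Y ≅ mk' (Γ.append Δ) h),
      p ≫ e.hom = e'.hom ≫ proj Γ Δ h := by
  induction hp with
  | of_isIso p => exact ⟨0, .nil, hΓ, asIso p ≪≫ e, (Category.comp_id _).symm⟩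
  | of_comp p q hp hq ih =>
    obtain ⟨k, Δ, h, e', w⟩ := ih e
    have hp' : T.displayMaps.pullbacks (p ≫ e'.hom) :=
      pullbacks_isPullback (f' := 𝟙 _) (f := e'.inv) (IsPullback.of_horiz_isIso ⟨by simp⟩) hp
    obtain ⟨A, h', e'', w'⟩ := exists_iso_display hp'
    refine ⟨k + 1, .snoc Δ A, h', e'', ?_⟩
    rw [Category.assoc, w, ← Category.assoc, w', Category.assoc]
    rfl

/-- Removing the types one by one exhibits the map as a composite of display maps. This starts the
induction for the factorisation. -/
theorem fibrations_to_nil {n : ℕ} {Φ : Ctx S n} (hΦ : T.WF Φ) {h : T.WF (.nil : Ctx S 0)}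
    (g : mk' Φ hΦ ⟶ mk' .nil h) : fibrations T.displayMaps g := by
  induction Φ with
  | nil =>
    obtain ⟨f, hf, rfl⟩ := exists_homMk g
    have : homMk hΦ h f hf = homMk h h (Sub.id 0) (isMor_id h) := homMk_eq_iff.2 trivial
    rw [this, homMk_id]
    exact .of_isIso _
  | snoc Φ A ih =>
    have : g = display hΦ ≫ homMk hΦ.1 h (fun i => i.elim0) trivial := by
      obtain ⟨f, hf, rfl⟩ := exists_homMk g
      exact (homMk_eq_iff (hf := hf) (hg := isMor_wk hΦ.2 (Ξ := .nil) (σ := fun i => i.elim0)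
        trivial)).2 trivial
    rw [this]
    exact fibrations_comp (fibrations_of_mem (displayMaps_display _)) (ih _ _)

end Theory

/-! ### Identity types as path objects, and the factorisation -/

namespace IdentityTypes

open Theory Cl

variable {T : Theory S} (I : IdentityTypes T)

/-- The reflexivity map, pulled back along a dependent projection. -/
theorem llp_diag {n k : ℕ} {Γ : Ctx S n} {A : Exp S n} (hA : T.Der Γ (.isType A))
    {Θ : Tel S (n + 3) k} (hΘ : T.WF ((I.ctx Γ A).append Θ))
    (h : T.WF ((Γ.snoc A).append (Θ.subst (I.diag A))))
    (hd : IsMor T.Der ((Γ.snoc A).append (Θ.subst (I.diag A))) ((I.ctx Γ A).append Θ)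
      ((I.diag A).lift k)) :
    T.displayMaps.llp (homMk h hΘ ((I.diag A).lift k) hd) := by
  refine llp_of_sections T.hasDisplayPullbacks _ fun E c d hc hdc => ?_
  obtain ⟨C, hC, e, rfl⟩ := exists_iso_display (le_pullbacks _ hc)
  obtain ⟨δ, hδ, w⟩ := exists_homMk (d ≫ e.hom)
  rw [← Category.assoc, w] at hdc
  have hm : MorEq T.Der _ _ (Fin.tail δ) ((I.diag A).lift k) :=
    (homMk_eq_iff (hf := hδ.1)).1 hdc
  -- The last entry of `δ` is an element of `C` over the diagonal, after conversion; elimination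
  -- extends it and computation says that it restricts back.
  obtain ⟨c, hc, hcd⟩ := I.exists_section hA hC.2
    (T.conv hδ.2 (T.subst_typeEq h hδ.1 hd hm hC.2))
  have hs : IsMor T.Der ((I.ctx Γ A).append Θ) (((I.ctx Γ A).append Θ).snoc C) (Sub.inst c) := by
    refine ⟨isMor_id hΘ, ?_⟩
    have : Fin.tail (Sub.inst c) = Sub.id _ := rfl
    rw [this, Exp.subst_id]
    exact hc
  refine ⟨homMk hΘ hC (Sub.inst c) hs ≫ e.inv, ?_, ?_⟩
  · rw [Category.assoc, e.inv_hom_id_assoc]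
    rfl
  · rw [← Category.assoc, Iso.comp_inv_eq, w]
    rw [homMk_comp, homMk_eq_iff]
    exact ⟨morEq_symm h hC.1 hδ.1 hd hm, hcd⟩

section

variable {n m : ℕ} {Γ : Ctx S n} {A : Exp S n}

/-- The projection `(Γ, x ∈ A, y ∈ A, u ∈ Id(x, y)) → Γ`. -/
def ctxProj (hA : T.Der Γ (.isType A)) :
    mk' (I.ctx Γ A) (I.wf_ctx hA) ⟶ mk' Γ (T.wf_of_der hA) :=
  display (I.wf_ctx hA) ≫ display (wf_pair hA) ≫ display (wf_pair hA).1

/-- The reflexivity map `x ↦ (x, x, r(x))`. -/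
def diagMap (hA : T.Der Γ (.isType A)) :
    mk' (Γ.snoc A) (wf_pair hA).1 ⟶ mk' (I.ctx Γ A) (I.wf_ctx hA) :=
  homMk _ _ (I.diag A) (I.isMor_diag hA)

theorem isPullback_ctxProj (hA : T.Der Γ (.isType A)) {Γ' : Ctx S m} (hΓ' : T.WF Γ')
    {σ : Sub S n m} (hσ : IsMor T.Der Γ' Γ σ) :
    IsPullback
      (homMk (I.wf_ctx (T.der_subst hΓ' hσ hA)) (I.wf_ctx hA) (σ.lift 3)
        (I.isMor_ctx_lift hA hΓ' hσ))
      (I.ctxProj (T.der_subst hΓ' hσ hA)) (I.ctxProj hA)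
      (homMk hΓ' (T.wf_of_der hA) σ hσ) := by
  have hA' := T.der_subst hΓ' hσ hA
  exact (isPullback_display (I.wf_ctx hA) (I.wf_ctx hA') (isMor_pair_lift hA hΓ' hσ)
    (I.typeEq_Id_lift hA hΓ' hσ)).paste_vert
      ((isPullback_display (wf_pair hA) (wf_pair hA') (isMor_snoc_lift hA hΓ' hσ)
        (typeEq_wk_lift hA hΓ' hσ)).paste_vert
          (isPullback_display (wf_pair hA).1 (wf_pair hA').1 hσ (T.type_refl hA')))

/-- Source and target of the reflexivity map are both pulled back along `σ`, so the square between
them is cartesian by cancellation. -/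
theorem isPullback_diagMap (hA : T.Der Γ (.isType A)) {Γ' : Ctx S m} (hΓ' : T.WF Γ')
    {σ : Sub S n m} (hσ : IsMor T.Der Γ' Γ σ) :
    IsPullback
      (homMk (wf_pair (T.der_subst hΓ' hσ hA)).1 (wf_pair hA).1 (σ.lift 1)
        (isMor_snoc_lift hA hΓ' hσ))
      (I.diagMap (T.der_subst hΓ' hσ hA)) (I.diagMap hA)
      (homMk (I.wf_ctx (T.der_subst hΓ' hσ hA)) (I.wf_ctx hA) (σ.lift 3)
        (I.isMor_ctx_lift hA hΓ' hσ)) := by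
  have hA' := T.der_subst hΓ' hσ hA
  refine IsPullback.of_bot ?_ ?_ (I.isPullback_ctxProj hA hΓ' hσ)
  · exact isPullback_display (wf_pair hA).1 (wf_pair hA').1 hσ (T.type_refl hA')
  · exact (homMk_eq_iff
      (hf := isMor_comp (wf_pair hA').1 (isMor_snoc_lift hA hΓ' hσ) (I.isMor_diag hA))
      (hg := isMor_comp (wf_pair hA').1 (I.isMor_diag hA') (I.isMor_ctx_lift hA hΓ' hσ))).2
        (I.morEq_diag_comp hA hΓ' hσ)

end

/-- Up to isomorphism the change of base is substitution along `σ` and the fibration `h` is the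
projection from a dependent context `Δ`. Then `b` is the reflexivity map over `Γ'` lifted along `Δ`,
which is the case of `llp_diag` with `Δ` as the parameters. -/
theorem llp_of_isPullback_diagMap {n : ℕ} {Γ : Ctx S n} {A : Exp S n}
    (hA : T.Der Γ (.isType A)) {X' P' : T.Cl} {f : X' ⟶ mk' Γ (T.wf_of_der hA)}
    {g : P' ⟶ mk' (I.ctx Γ A) (I.wf_ctx hA)} {q : P' ⟶ X'}
    (sq : IsPullback g q (I.ctxProj hA) f) {Y : T.Cl} {h : Y ⟶ P'}
    (hh : fibrations T.displayMaps h) {E' : T.Cl} {a : E' ⟶ mk' (Γ.snoc A) (wf_pair hA).1}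
    {b : E' ⟶ Y} (sq' : IsPullback a b (I.diagMap hA) (h ≫ g)) : T.displayMaps.llp b := by
  obtain ⟨m, Γ', hΓ', rfl⟩ := X'.exists_eq_mk'
  obtain ⟨σ, hσ, rfl⟩ := exists_homMk f
  have hA' : T.Der Γ' (.isType (A.subst σ)) := T.der_subst hΓ' hσ hA
  have sq₁ := I.isPullback_ctxProj hA hΓ' hσ
  obtain ⟨k, Δ, hΔ, e, he⟩ := exists_iso_proj hh (sq.isoIsPullback _ _ sq₁)
  obtain ⟨hW, hd⟩ := isMor_lift (wf_pair hA').1 (I.isMor_diag hA') hΔ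
  have sq₂ := (isPullback_proj hΔ (wf_pair hA').1 (I.isMor_diag hA')).flip.paste_horiz
    (I.isPullback_diagMap hA hΓ' hσ)
  have hg : h ≫ g = e.hom ≫ proj _ Δ hΔ ≫ homMk _ _ _ (I.isMor_ctx_lift hA hΓ' hσ) := by
    rw [← reassoc_of% he, sq.isoIsPullback_hom_fst _ _ sq₁]
  rw [hg] at sq'
  have sq₃ : IsPullback a (b ≫ e.hom) (I.diagMap hA)
      (proj _ Δ hΔ ≫ homMk _ _ _ (I.isMor_ctx_lift hA hΓ' hσ)) := by
    have := sq'.paste_vert (IsPullback.of_vert_isIso (f := 𝟙 _) (snd := e.hom)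
      (fst := e.hom ≫ proj _ Δ hΔ ≫ homMk _ _ _ (I.isMor_ctx_lift hA hΓ' hσ))
      (g := proj _ Δ hΔ ≫ homMk _ _ _ (I.isMor_ctx_lift hA hΓ' hσ)) ⟨by simp⟩)
    rwa [Category.comp_id] at this
  have hb : b = (sq₃.isoIsPullback _ _ sq₂).hom ≫ homMk hW hΔ _ hd ≫ e.inv := by
    have := sq₃.isoIsPullback_hom_snd _ _ sq₂
    rw [← Category.assoc, Iso.eq_comp_inv]
    exact this.symm
  rw [hb]
  exact MorphismProperty.comp_mem _ _ _ (MorphismProperty.llp_of_isIso _ _)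
    (MorphismProperty.comp_mem _ _ _ (I.llp_diag hA' hΔ hW hd)
      (MorphismProperty.llp_of_isIso _ _))

theorem nonempty_pathObject (I : IdentityTypes T) {E X : T.Cl} (p : E ⟶ X) (hp : T.displayMaps p) :
    Nonempty (PathObject T.displayMaps p) := by
  obtain ⟨Γ, A, h⟩ := hp
  have hA : T.Der Γ (.isType A) := h.2
  exact ⟨{
    isPullback := (isPullback_display h (wf_pair hA) (isMor_wk hA (isMor_id h.1))
      (T.type_refl (wf_pair hA).2)).flip
    display := displayMaps_display (I.wf_ctx hA)
    refl := I.diagMap hA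
    refl_fst := rfl
    refl_snd := by
      have e : (((Sub.wk _ 1).lift 1).comp (Sub.wk _ 1)).comp (I.diag A) = Sub.id _ := by
        refine funext fun i => Fin.cases rfl (fun i => rfl) i
      have hm : IsMor T.Der (Γ.snoc A) (Γ.snoc A)
          ((((Sub.wk _ 1).lift 1).comp (Sub.wk _ 1)).comp (I.diag A)) := e ▸ isMor_id h
      exact (homMk_eq_iff (hf := hm) (hg := isMor_id h)).2
        (by rw [e]; exact morEq_refl (isMor_id h))
    llp_of_isPullback := fun _ _ _ _ _ sq _ _ hh _ _ _ sq' =>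
      I.llp_of_isPullback_diagMap hA sq hh sq' }⟩

theorem exists_factorization (I : IdentityTypes T) {X Y : T.Cl} (f : X ⟶ Y) :
    ∃ (Z : T.Cl) (i : X ⟶ Z) (g : Z ⟶ Y),
      T.displayMaps.llp i ∧ fibrations T.displayMaps g ∧ i ≫ g = f := by
  obtain ⟨n, Φ, hΦ, rfl⟩ := X.exists_eq_mk'
  obtain ⟨m, Ψ, hΨ, rfl⟩ := Y.exists_eq_mk'
  induction Ψ with
  | nil => exact ⟨_, 𝟙 _, f, MorphismProperty.id_mem _ _, fibrations_to_nil hΦ f,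
      Category.id_comp f⟩
  | snoc Ψ B ih =>
    exact exists_factorization_of_display T.hasDisplayPullbacks
      (fun _ _ p hp => I.nonempty_pathObject p hp) (displayMaps_display hΨ) f (ih _ _)

end IdentityTypes

end TypeTheory

/-! ### The weak factorisation system -/

theorem mainTheorem1 {S : TypeTheory.Signature.{u}} (T : TypeTheory.Theory S)
    (_I : TypeTheory.IdentityTypes T) :
    T.displayMaps.llp.IsWeakFactorizationSystem T.displayMaps.llp.rlp ∧
      ∀ ⦃X Y : T.Cl⦄ (f : Quiver.Hom X Y), ∃ (Z : T.Cl) (i : Quiver.Hom X Z) (p : Quiver.Hom Z Y),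
        T.displayMaps.llp i ∧ T.dependentProjections p ∧
          CategoryTheory.CategoryStruct.comp i p = f := by
  refine ⟨⟨rfl, T.displayMaps.llp_rlp_llp, ⟨fun f => ?_⟩⟩, fun X Y f => ?_⟩
  · obtain ⟨Z, i, g, hi, hg, w⟩ := _I.exists_factorization f
    exact ⟨{ Z := Z, i := i, p := g, fac := w, hi := hi,
             hp := TypeTheory.le_llp_rlp_of_fibrations hg }⟩
  · obtain ⟨n, Ψ, hΨ, rfl⟩ := Y.exists_eq_mk'
    obtain ⟨Z, i, g, hi, hg, w⟩ := _I.exists_factorization f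
    -- The fibration is a dependent projection up to an isomorphism of its domain, which is absorbed
    -- into the left factor.
    obtain ⟨k, Δ, h, e, he⟩ := TypeTheory.Theory.exists_iso_proj hg (CategoryTheory.Iso.refl _)
    refine ⟨_, CategoryTheory.CategoryStruct.comp i e.hom, _,
      CategoryTheory.MorphismProperty.comp_mem _ _ _ hi
        (CategoryTheory.MorphismProperty.llp_of_isIso _ _), .mk Ψ Δ h, ?_⟩
    rw [CategoryTheory.Category.assoc, ← he, CategoryTheory.Iso.refl_hom,
      CategoryTheory.Category.comp_id, w]
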